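/- Let $p$ be a prime and $k$ a perfect field of characteristic $p$; $W(\cdot)$ denotes $p$-typical Witt vectors. Let $D_k$ be the Dieudonné ring of $k$, generated by $W(k)$ and elements $F,V$ with $Fa=\sigma(a)F$, $V\sigma(a)=aV$ ($a\in W(k)$, $\sigma$ the Witt vector Frobenius) and $FV=VF=p$; let $W(k)[F]\subset D_k$ be the subring generated by $W(k)$ and $F$. Let $N$ be a $D_k$-module that is free and finitely generated over $W(k)$ and on which $V$ is topologically nilpotent for the $p$-adic topology (for every $n$ one has $V^mN\subset p^nN$ for all large $m$). Let $C$ be a good $k$-algebra, i.e. a $k$-algebra isomorphic to $$B[x_1^{p^{-\infty}},\ldots,x_n^{p^{-\infty}}]/(x_1,\ldots,x_n)$$ for some perfect $k$-algebra $B$ and some $n\ge 0$, where the numerator ring consists of the finite sums $\sum_\alpha b_\alpha x^\alpha$ with $b_\alpha\in B$ and $\alpha\in(\mathbb Z[1/p]_{\ge 0})^n$. Let $C^\flat=\varprojlim(\cdots\to C\to C)$ be the inverse limit along $x\mapsto x^p$, let $\nu_0:C^\flat\to C$ be the projection $(c_0,c_1,\ldots)\mapsto c_0$, and let $A_{\mathrm{cris}}(C)$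 be the $p$-adic completion of the PD hull of the epimorphism $W(C^\flat)\to C$ induced by $\nu_0$ (the divided powers being required to satisfy $\gamma_m(p)=p^m/m!$). It carries the endomorphism $F$ induced by the Frobenius of $C$, and it is a $W(k)$-algebra via $W(k)\to W(C^\flat)$, the map induced by the unique lift $k\to C^\flat$ of $k\to C$. The ideal $\ker(W(C)\to C)=VW(C)$ has the PD structure $\gamma_n(Va)=\frac{p^{n-1}}{n!}V(a^n)$ for $n\ge 1$, so $W(\nu_0):W(C^\flat)\to W(C)$ extends uniquely to a (continuous) PD homomorphism $\beta:A_{\mathrm{cris}}(C)\to W(C)$. Then for every $W(k)[F]$-linear map $f:N\to A_{\mathrm{cris}}(C)$ the map $\beta\circ f$ is $D_k$-linear, where $F$ and $V$ act on $W(C)$ as Witt vector Frobenius and Verschiebung, and $f\mapsto\beta\circ f$ is an isomorphism of abelian groups $$\operatorname{Hom}_{W(k)[F]}(N,A_{\mathrm{cris}}(C))\xrightarrow{\ \sim\ }\operatorname{Hom}_{D_k}(N,W(C)).$$ -/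

import Mathlib

noncomputable section

namespace Acris

open WittVector Finset

/-! ### Auxiliary constants in `ℤ_p` and the map `ℤ_p → W(A)` -/

section Witt

variable (p : ℕ) [hp : Fact p.Prime]

theorem norm_pdCoeff_le (n : ℕ) :
    ‖((p : ℚ_[p]) ^ (n - 1) / (n.factorial : ℚ_[p]))‖ ≤ 1 := by
  have hp0 : (p : ℚ_[p]) ≠ 0 := by exact_mod_cast hp.1.ne_zero
  rcases Nat.eq_zero_or_pos n with rfl | hn
  · simp
  have hmem : (p : ℤ_[p]) ∈ Ideal.span {(p : ℤ_[p])} := Ideal.mem_span_singleton_self _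
  obtain ⟨b, hb⟩ := Ideal.mem_span_singleton'.1
    ((PadicInt.dividedPowers p).dpow_mem hn.ne' hmem)
  have h := PadicInt.coe_dpow_eq p n (p : ℤ_[p])
  rw [dif_pos hmem, ← hb] at h
  have h2 : ((p : ℚ_[p]) ^ (n - 1) / (n.factorial : ℚ_[p])) = (b : ℚ_[p]) := by
    obtain ⟨m, rfl⟩ := Nat.exists_eq_succ_of_ne_zero hn.ne'
    apply mul_right_cancel₀ hp0
    push_cast at h
    rw [h, Ring.inverse_eq_inv', Nat.succ_sub_one, Nat.succ_eq_add_one, pow_succ]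
    ring
  rw [h2]
  exact b.2

/-- The `p`-adic integer `p ^ (n - 1) / n!` (relevant for `n ≥ 1`). -/
def pdCoeff (n : ℕ) : ℤ_[p] :=
  ⟨(p : ℚ_[p]) ^ (n - 1) / (n.factorial : ℚ_[p]), norm_pdCoeff_le p n⟩

theorem coe_pdCoeff (n : ℕ) :
    (pdCoeff p n : ℚ_[p]) = (p : ℚ_[p]) ^ (n - 1) / (n.factorial : ℚ_[p]) := rfl

theorem pdCoeff_one : pdCoeff p 1 = 1 := by
  apply Subtype.ext; simp [pdCoeff]

theorem pdCoeff_mul {m n : ℕ} (hm : m ≠ 0) (hn : n ≠ 0) :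
    pdCoeff p m * pdCoeff p n * p = (Nat.choose (m + n) m : ℤ_[p]) * pdCoeff p (m + n) := by
  apply Subtype.ext
  obtain ⟨m, rfl⟩ := Nat.exists_eq_succ_of_ne_zero hm
  obtain ⟨n, rfl⟩ := Nat.exists_eq_succ_of_ne_zero hn
  have h := Nat.add_choose_mul_factorial_mul_factorial n.succ m.succ
  rw [add_comm n.succ m.succ, mul_assoc, mul_comm n.succ.factorial, ← mul_assoc] at h
  have h' : ((m.succ + n.succ).choose m.succ : ℚ_[p]) * (m.succ.factorial : ℚ_[p])
      * (n.succ.factorial : ℚ_[p]) = ((m.succ + n.succ).factorial : ℚ_[p]) := by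
    exact_mod_cast h
  have h1 : (m.succ.factorial : ℚ_[p]) ≠ 0 := by exact_mod_cast Nat.factorial_ne_zero _
  have h2 : (n.succ.factorial : ℚ_[p]) ≠ 0 := by exact_mod_cast Nat.factorial_ne_zero _
  have h3 : ((m.succ + n.succ).factorial : ℚ_[p]) ≠ 0 := by
    exact_mod_cast Nat.factorial_ne_zero _
  have e : m.succ + n.succ - 1 = m + n + 1 := by omega
  simp only [PadicInt.coe_mul, PadicInt.coe_natCast, coe_pdCoeff, e, Nat.succ_sub_one]
  rw [div_mul_div_comm, div_mul_eq_mul_div, mul_div_assoc', div_eq_div_iff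
    (mul_ne_zero h1 h2) h3, ← h']
  ring

theorem pdCoeff_comp {m n : ℕ} (hm : m ≠ 0) (hn : n ≠ 0) :
    pdCoeff p m * pdCoeff p n ^ m = (Nat.uniformBell m n : ℤ_[p]) * pdCoeff p (m * n) := by
  apply Subtype.ext
  have h := Nat.uniformBell_mul_eq m hn
  have h' : (m.uniformBell n : ℚ_[p]) * (n.factorial : ℚ_[p]) ^ m * (m.factorial : ℚ_[p])
      = ((m * n).factorial : ℚ_[p]) := by exact_mod_cast h
  have h1 : (m.factorial : ℚ_[p]) ≠ 0 := by exact_mod_cast Nat.factorial_ne_zero _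
  have h2 : (n.factorial : ℚ_[p]) ≠ 0 := by exact_mod_cast Nat.factorial_ne_zero _
  have h3 : ((m * n).factorial : ℚ_[p]) ≠ 0 := by exact_mod_cast Nat.factorial_ne_zero _
  obtain ⟨m, rfl⟩ := Nat.exists_eq_succ_of_ne_zero hm
  obtain ⟨n, rfl⟩ := Nat.exists_eq_succ_of_ne_zero hn
  have e : m.succ * n.succ - 1 = m + n * m.succ := by
    rw [Nat.succ_mul_succ]; simp only [Nat.succ_eq_add_one]; ring_nf; omega
  simp only [PadicInt.coe_mul, PadicInt.coe_natCast, PadicInt.coe_pow, coe_pdCoeff, e,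
    Nat.succ_sub_one]
  rw [div_pow, div_mul_div_comm, mul_div_assoc', div_eq_div_iff
    (mul_ne_zero h1 (pow_ne_zero _ h2)) h3, ← h', pow_add, pow_mul]
  ring

theorem dpow_p_mul {n : ℕ} (hn : n ≠ 0) (b : ℤ_[p]) :
    (PadicInt.dividedPowers p).dpow n (b * p) = pdCoeff p n * b ^ n * p := by
  apply Subtype.ext
  have hmem : b * (p : ℤ_[p]) ∈ Ideal.span {(p : ℤ_[p])} :=
    Ideal.mem_span_singleton'.2 ⟨b, rfl⟩
  have h := PadicInt.coe_dpow_eq p n (b * p)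
  rw [dif_pos hmem] at h
  rw [h]
  obtain ⟨n, rfl⟩ := Nat.exists_eq_succ_of_ne_zero hn
  simp only [PadicInt.coe_mul, PadicInt.coe_natCast, PadicInt.coe_pow,
    coe_pdCoeff, Nat.succ_sub_one, Ring.inverse_eq_inv', Nat.succ_eq_add_one, mul_pow]
  rw [pow_succ (p : ℚ_[p])]
  ring

section

variable {p} {A : Type*} [CommRing A]

theorem map_frobenius' {B : Type*} [CommRing B] (g : B →+* A)
    (x : WittVector p B) :
    WittVector.map g (WittVector.frobenius x) = WittVector.frobenius (WittVector.map g x) := by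
  ext n
  simp only [WittVector.map_coeff, WittVector.coeff_frobenius, MvPolynomial.aeval_def,
    MvPolynomial.hom_eval₂]
  congr 1
  exact RingHom.ext_int _ _

theorem verschiebung_mul_verschiebung (x y : WittVector p A) :
    verschiebung x * verschiebung y = p * verschiebung (x * y) := by
  rw [← verschiebung_mul_frobenius, frobenius_verschiebung, ← mul_assoc]
  have : verschiebung (x * y * (p : WittVector p A)) = verschiebung (x * y * frobenius (p : WittVector p A)) := by
    simp
  rw [this, verschiebung_mul_frobenius, mul_comm]

theorem verschiebung_shift_of_mem {x : WittVector p A}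
    (hx : x ∈ RingHom.ker (constantCoeff : WittVector p A →+* A)) :
    verschiebung (x.shift 1) = x := by
  have := verschiebung_shift x 0 (by
    intro i hi
    obtain rfl : i = 0 := by omega
    exact hx)
  rw [this]
  ext i; simp [shift_coeff]

theorem verschiebung_mem_ker (x : WittVector p A) :
    verschiebung x ∈ RingHom.ker (constantCoeff : WittVector p A →+* A) :=
  verschiebung_coeff_zero x

theorem shift_verschiebung (x : WittVector p A) : (verschiebung x).shift 1 = x := by
  ext i; rw [shift_coeff, add_comm, verschiebung_coeff_add_one]

end

variable (A : Type*) [CommRing A] [Algebra (ZMod p) A]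

/-- The canonical homomorphism `ℤ_p = W(𝔽_p) → W(A)` for an `𝔽_p`-algebra `A`. -/
def zpToWitt : ℤ_[p] →+* WittVector p A :=
  (WittVector.map (algebraMap (ZMod p) A)).comp (WittVector.equiv p).symm.toRingHom

variable {p A}

theorem frobenius_zpToWitt (b : ℤ_[p]) :
    frobenius (zpToWitt p A b) = zpToWitt p A b := by
  simp only [zpToWitt, RingHom.comp_apply]
  rw [← map_frobenius', frobenius_zmodp]

theorem zpToWitt_mul_verschiebung (b : ℤ_[p]) (x : WittVector p A) :
    zpToWitt p A b * verschiebung x = verschiebung (zpToWitt p A b * x) := by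
  conv_rhs => rw [mul_comm, ← frobenius_zpToWitt, verschiebung_mul_frobenius, mul_comm]

variable (p A) in
theorem verschiebung_one : verschiebung (1 : WittVector p A) = p := by
  have h := verschiebung_zmod (p := p) (1 : WittVector p (ZMod p))
  have h2 := congrArg (WittVector.map (algebraMap (ZMod p) A)) h
  rw [map_verschiebung] at h2
  simpa using h2

open scoped Classical in
/-- The functions `γ_n (V a) = (p ^ (n - 1) / n!) V (a ^ n)` for `n ≥ 1`, and `γ_0 = 1`,
on the ideal `V W(A) = Ker (W(A) → A)`; extended by zero outside of the ideal. -/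
def wittDpow (n : ℕ) (x : WittVector p A) : WittVector p A :=
  if x ∈ RingHom.ker (constantCoeff : WittVector p A →+* A) then
    if n = 0 then 1 else zpToWitt p A (pdCoeff p n) * verschiebung (x.shift 1 ^ n)
  else 0

theorem wittDpow_zero {x : WittVector p A} (hx : x ∈ RingHom.ker (constantCoeff : WittVector p A →+* A)) :
    wittDpow 0 x = 1 := by
  simp [wittDpow, if_pos hx]

theorem wittDpow_zero_V (a : WittVector p A) : wittDpow 0 (verschiebung a) = 1 :=
  wittDpow_zero (verschiebung_mem_ker a)

theorem wittDpow_V {n : ℕ} (hn : n ≠ 0) (a : WittVector p A) :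
    wittDpow n (verschiebung a) =
      zpToWitt p A (pdCoeff p n) * verschiebung (a ^ n) := by
  rw [wittDpow, if_pos (verschiebung_mem_ker a), if_neg hn, shift_verschiebung]

theorem exists_eq_V {x : WittVector p A} (hx : x ∈ RingHom.ker (constantCoeff : WittVector p A →+* A)) :
    ∃ a, x = verschiebung a := ⟨_, (verschiebung_shift_of_mem hx).symm⟩

theorem wittDpow_mul_V (m n : ℕ) (a : WittVector p A) :
    wittDpow m (verschiebung a) * wittDpow n (verschiebung a) =
      (Nat.choose (m + n) m : WittVector p A) * wittDpow (m + n) (verschiebung a) := by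
  rcases eq_or_ne m 0 with rfl | hm
  · simp [wittDpow_zero_V]
  rcases eq_or_ne n 0 with rfl | hn
  · simp [wittDpow_zero_V]
  rw [wittDpow_V hm, wittDpow_V hn, wittDpow_V (by omega), mul_mul_mul_comm,
    verschiebung_mul_verschiebung, ← pow_add, ← mul_assoc, ← mul_assoc, ← map_mul]
  congr 1
  have := congrArg (zpToWitt p A) (pdCoeff_mul p hm hn)
  simpa using this

theorem wittDpow_add_V (n : ℕ) (a b : WittVector p A) :
    wittDpow n (verschiebung a + verschiebung b) =
      ∑ k ∈ antidiagonal n, wittDpow k.1 (verschiebung a) * wittDpow k.2 (verschiebung b) := by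
  rw [← map_add]
  rcases eq_or_ne n 0 with rfl | hn
  · rw [wittDpow_zero_V]; simp [wittDpow_zero_V]
  rw [wittDpow_V hn, Commute.add_pow' (Commute.all a b), map_sum, mul_sum]
  refine sum_congr rfl fun k hk => ?_
  obtain ⟨i, j⟩ := k
  rw [HasAntidiagonal.mem_antidiagonal] at hk
  subst hk
  simp only
  rcases eq_or_ne i 0 with rfl | hi
  · rw [wittDpow_zero_V, wittDpow_V (by simpa using hn)]; simp
  rcases eq_or_ne j 0 with rfl | hj
  · rw [wittDpow_zero_V, wittDpow_V hi]; simp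
  rw [wittDpow_V hi, wittDpow_V hj, mul_mul_mul_comm, verschiebung_mul_verschiebung,
    map_nsmul, nsmul_eq_mul, ← mul_assoc, ← mul_assoc, ← map_mul]
  congr 1
  have := congrArg (zpToWitt p A) (pdCoeff_mul p hi hj)
  rw [mul_comm (zpToWitt p A _)]
  simpa using this.symm

theorem wittDpow_smul_V (n : ℕ) (r a : WittVector p A) :
    wittDpow n (r * verschiebung a) = r ^ n * wittDpow n (verschiebung a) := by
  have e : r * verschiebung a = verschiebung (a * frobenius r) := by
    rw [verschiebung_mul_frobenius, mul_comm]
  rw [e]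
  rcases eq_or_ne n 0 with rfl | hn
  · simp [wittDpow_zero_V]
  rw [wittDpow_V hn, wittDpow_V hn, mul_pow, ← map_pow, verschiebung_mul_frobenius]
  ring

variable (p A) in
/-- The canonical PD structure on the ideal `V W(A) = Ker (W(A) → A)`. -/
def wittDividedPowers : DividedPowers (RingHom.ker (constantCoeff : WittVector p A →+* A)) where
  dpow := wittDpow
  dpow_null hx := by rw [wittDpow, if_neg hx]
  dpow_zero hx := wittDpow_zero hx
  dpow_one hx := by
    obtain ⟨a, rfl⟩ := exists_eq_V hx
    rw [wittDpow_V one_ne_zero, pdCoeff_one]; simp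
  dpow_mem hn hx := by
    obtain ⟨a, rfl⟩ := exists_eq_V hx
    rw [wittDpow_V hn]
    exact Ideal.mul_mem_left _ _ (verschiebung_mem_ker _)
  dpow_add hx hy := by
    obtain ⟨a, rfl⟩ := exists_eq_V hx
    obtain ⟨b, rfl⟩ := exists_eq_V hy
    exact wittDpow_add_V _ _ _
  dpow_mul hx := by
    obtain ⟨a, rfl⟩ := exists_eq_V hx
    exact wittDpow_smul_V _ _ _
  mul_dpow hx := by
    obtain ⟨a, rfl⟩ := exists_eq_V hx
    exact wittDpow_mul_V _ _ _
  dpow_comp {m n x} hn hx := by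
    obtain ⟨a, rfl⟩ := exists_eq_V hx
    rcases eq_or_ne m 0 with rfl | hm
    · rw [wittDpow_V hn, zpToWitt_mul_verschiebung, wittDpow_zero_V, zero_mul,
        wittDpow_zero_V, Nat.uniformBell_zero_left, Nat.cast_one, one_mul]
    · rw [wittDpow_V hn, zpToWitt_mul_verschiebung, wittDpow_V hm,
        wittDpow_V (mul_ne_zero hm hn), mul_pow, ← map_pow, ← zpToWitt_mul_verschiebung,
        ← mul_assoc, ← mul_assoc, ← map_mul, pdCoeff_comp p hm hn, ← pow_mul, mul_comm n m]
      simp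

/-- Compatibility of the canonical PD structure with the one on `p ℤ_p`. -/
theorem wittDpow_zpToWitt (n : ℕ) {a : ℤ_[p]} (ha : a ∈ Ideal.span {(p : ℤ_[p])}) :
    (wittDividedPowers p A).dpow n (zpToWitt p A a) =
      zpToWitt p A ((PadicInt.dividedPowers p).dpow n a) := by
  obtain ⟨b, rfl⟩ := Ideal.mem_span_singleton'.1 ha
  have e : zpToWitt p A (b * p) = verschiebung (zpToWitt p A b) := by
    rw [map_mul, map_natCast, ← verschiebung_one, zpToWitt_mul_verschiebung, mul_one]
  change wittDpow n _ = _
  rcases eq_or_ne n 0 with rfl | hn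
  · rw [e, wittDpow_zero_V, (PadicInt.dividedPowers p).dpow_zero ha, map_one]
  · rw [e, wittDpow_V hn, dpow_p_mul p hn, ← map_pow, map_mul, map_mul, mul_assoc]
    congr 1
    rw [map_natCast, ← verschiebung_one, zpToWitt_mul_verschiebung, mul_one]

end Witt

/-! ### PD hulls -/

section PDHull

variable {p : ℕ} [hp : Fact p.Prime]
variable {R : Type*} [CommRing R] (z : ℤ_[p] →+* R) (J : Ideal R)

/-- The relations that cut out the PD hull of `(R, J)` from the divided power algebra
`Γ_R(J)`: the degree one elements `x^{[1]}` are identified with the elements `x` of `J`, and the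
divided powers of `J` are compatible with the canonical ones on `p ℤ_p`
(so that `γ_n(p) = p ^ n / n!`). -/
def pdRelations : Ideal (DividedPowerAlgebra R J) :=
  Ideal.span
    ({d | ∃ x : J, d = DividedPowerAlgebra.dp R 1 x - algebraMap R _ (x : R)} ∪
     {d | ∃ (n : ℕ) (a : ℤ_[p]) (x : J), a ∈ Ideal.span {(p : ℤ_[p])} ∧ (x : R) = z a ∧
        d = DividedPowerAlgebra.dp R n x -
          algebraMap R _ (z ((PadicInt.dividedPowers p).dpow n a))})

/-- The PD hull (divided power envelope) of the ideal `J` in the `ℤ_p`-algebra `R`, where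
`p ∈ J`; divided powers are required to be compatible with those on `p ℤ_p`. This is the
Berthelot-Ogus construction as a quotient of `Γ_R(J)`; the formula for `γ_m(γ_n(x))` needs no
separate relation, because it already holds in `Γ_R(J)`. -/
def PDHull : Type _ := DividedPowerAlgebra R J ⧸ pdRelations z J

instance : CommRing (PDHull z J) :=
  inferInstanceAs (CommRing (DividedPowerAlgebra R J ⧸ pdRelations z J))

namespace PDHull

/-- The structure map `R → PDHull`. -/
def of : R →+* PDHull z J :=
  (Ideal.Quotient.mk (pdRelations z J)).comp (algebraMap R (DividedPowerAlgebra R J))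

/-- The divided power `γ_n(x)`, for `x ∈ J`, in the PD hull. -/
def dp (n : ℕ) (x : J) : PDHull z J :=
  Ideal.Quotient.mk (pdRelations z J) (DividedPowerAlgebra.dp R n x)

variable {z J}

theorem dp_zero (x : J) : dp z J 0 x = 1 := by
  rw [dp, DividedPowerAlgebra.dp_zero]; exact map_one (Ideal.Quotient.mk _)

theorem dp_one (x : J) : dp z J 1 x = of z J x :=
  Ideal.Quotient.eq.2 (Ideal.subset_span (Or.inl ⟨x, rfl⟩))

theorem dp_smul (n : ℕ) (r : R) (x : J) : dp z J n (r • x) = of z J r ^ n * dp z J n x := by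
  rw [dp, DividedPowerAlgebra.dp_smul, Algebra.smul_def, map_pow]
  refine (map_mul (Ideal.Quotient.mk (pdRelations z J)) _ _).trans ?_
  rw [map_pow]; rfl

theorem dp_mul (m n : ℕ) (x : J) :
    dp z J m x * dp z J n x = (m + n).choose m • dp z J (m + n) x := by
  refine (map_mul (Ideal.Quotient.mk (pdRelations z J)) _ _).symm.trans ?_
  rw [DividedPowerAlgebra.dp_mul]
  exact map_nsmul (Ideal.Quotient.mk (pdRelations z J)) _ _

theorem dp_add (n : ℕ) (x y : J) :
    dp z J n (x + y) = ∑ k ∈ antidiagonal n, dp z J k.1 x * dp z J k.2 y := by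
  rw [dp, DividedPowerAlgebra.dp_add]
  refine (map_sum (Ideal.Quotient.mk (pdRelations z J)) _ _).trans ?_
  exact sum_congr rfl fun k _ => map_mul (Ideal.Quotient.mk (pdRelations z J)) _ _

theorem dp_compat (n : ℕ) {a : ℤ_[p]} (ha : a ∈ Ideal.span {(p : ℤ_[p])}) (x : J)
    (hx : (x : R) = z a) :
    dp z J n x = of z J (z ((PadicInt.dividedPowers p).dpow n a)) :=
  Ideal.Quotient.eq.2 (Ideal.subset_span (Or.inr ⟨n, a, x, ha, hx, rfl⟩))

/-- Homomorphisms out of the PD hull. -/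
def lift {A : Type*} [CommRing A] (g : R →+* A) (f : ℕ → J → A)
    (f_zero : ∀ x, f 0 x = 1) (f_one : ∀ x, f 1 x = g x)
    (f_smul : ∀ n (r : R) x, f n (r • x) = g r ^ n * f n x)
    (f_mul : ∀ m n x, f m x * f n x = (m + n).choose m • f (m + n) x)
    (f_add : ∀ n x y, f n (x + y) = ∑ k ∈ antidiagonal n, f k.1 x * f k.2 y)
    (f_compat : ∀ n, ∀ a ∈ Ideal.span {(p : ℤ_[p])}, ∀ x : J, (x : R) = z a →
      f n x = g (z ((PadicInt.dividedPowers p).dpow n a))) :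
    PDHull z J →+* A :=
  letI : Algebra R A := g.toAlgebra
  Ideal.Quotient.lift (pdRelations z J)
    (DividedPowerAlgebra.lift' (R := R) (M := J) (A := A) (f := fun nm => f nm.1 nm.2)
      f_zero (fun n r x => by
        rw [Algebra.smul_def, map_pow]; exact f_smul n r x) f_mul f_add).toRingHom
    (by
      intro d hd
      rw [← RingHom.mem_ker]
      revert d
      change pdRelations z J ≤ _
      rw [pdRelations, Ideal.span_le]
      rintro d (⟨x, rfl⟩ | ⟨n, a, x, ha, hx, rfl⟩)
      · rw [SetLike.mem_coe, RingHom.mem_ker, map_sub, sub_eq_zero]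
        simp only [AlgHom.toRingHom_eq_coe, RingHom.coe_coe,
          DividedPowerAlgebra.lift'_apply_dp, AlgHom.commutes]
        exact f_one x
      · rw [SetLike.mem_coe, RingHom.mem_ker, map_sub, sub_eq_zero]
        simp only [AlgHom.toRingHom_eq_coe, RingHom.coe_coe,
          DividedPowerAlgebra.lift'_apply_dp, AlgHom.commutes]
        exact f_compat n a ha x hx)

section lift

variable {A : Type*} [CommRing A] (g : R →+* A) (f : ℕ → J → A)
    (f_zero : ∀ x, f 0 x = 1) (f_one : ∀ x, f 1 x = g x)
    (f_smul : ∀ n (r : R) x, f n (r • x) = g r ^ n * f n x)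
    (f_mul : ∀ m n x, f m x * f n x = (m + n).choose m • f (m + n) x)
    (f_add : ∀ n x y, f n (x + y) = ∑ k ∈ antidiagonal n, f k.1 x * f k.2 y)
    (f_compat : ∀ n, ∀ a ∈ Ideal.span {(p : ℤ_[p])}, ∀ x : J, (x : R) = z a →
      f n x = g (z ((PadicInt.dividedPowers p).dpow n a)))

theorem lift_of (r : R) :
    lift g f f_zero f_one f_smul f_mul f_add f_compat (of z J r) = g r := by
  let _ : Algebra R A := g.toAlgebra
  exact (DividedPowerAlgebra.lift' (R := R) (M := J) (A := A)
    (f := fun nm => f nm.1 nm.2) f_zero (fun n r x => by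
        rw [Algebra.smul_def, map_pow]; exact f_smul n r x) f_mul f_add).commutes r

theorem lift_dp (n : ℕ) (x : J) :
    lift g f f_zero f_one f_smul f_mul f_add f_compat (dp z J n x) = f n x := by
  let _ : Algebra R A := g.toAlgebra
  exact DividedPowerAlgebra.lift'_apply_dp (R := R) (M := J) (A := A)
    (f := fun nm => f nm.1 nm.2) f_zero (fun n r x => by
        rw [Algebra.smul_def, map_pow]; exact f_smul n r x) f_mul f_add n x

end lift

variable {R' : Type*} [CommRing R'] {z' : ℤ_[p] →+* R'} {J' : Ideal R'}

/-- Functoriality of the PD hull: `γ_n(x) ↦ γ_n(g(x))`. -/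
def map (g : R →+* R') (hg : ∀ x ∈ J, g x ∈ J') (hz : ∀ a, g (z a) = z' a) :
    PDHull z J →+* PDHull z' J' :=
  lift ((of z' J').comp g) (fun n x => dp z' J' n ⟨g x, hg x x.2⟩)
    (fun x => dp_zero _) (fun x => dp_one _)
    (fun n r x => (congrArg (dp z' J' n) (Subtype.ext (map_mul g r x))).trans
      (dp_smul n (g r) ⟨g x, hg x x.2⟩))
    (fun m n x => dp_mul m n _)
    (fun n x y => (congrArg (dp z' J' n) (Subtype.ext (map_add g (x : R) y))).trans
      (dp_add n ⟨g x, hg x x.2⟩ ⟨g y, hg y y.2⟩))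
    (fun n a ha x hx => (dp_compat n ha ⟨g x, hg x x.2⟩ (by rw [← hz, ← hx])).trans
      (congrArg (of z' J') (hz _).symm))

end PDHull

end PDHull

/-! ### `p`-adic completion of a ring -/

section Completion

variable (p : ℕ)

/-- The `p`-adic completion of a ring. -/
abbrev PCompletion (D : Type*) [CommRing D] : Type _ :=
  AdicCompletion (Ideal.span {(p : D)}) D

theorem evalₐ_of_le {R : Type*} [CommRing R] (I : Ideal R) {m n : ℕ} (hmn : m ≤ n)
    (x : AdicCompletion I R) (y : R) (hy : Ideal.Quotient.mk (I ^ n) y =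
      AdicCompletion.evalₐ I n x) :
    AdicCompletion.evalₐ I m x = Ideal.Quotient.mk (I ^ m) y := by
  induction x using AdicCompletion.induction_on with
  | _ x =>
  rw [AdicCompletion.evalₐ_mk, Ideal.Quotient.eq] at hy
  rw [AdicCompletion.evalₐ_mk, ← AdicCompletion.Ideal.mk_eq_mk I hmn x, eq_comm,
    Ideal.Quotient.eq]
  exact Ideal.pow_le_pow_right hmn hy

/-- Functoriality of the `p`-adic completion. -/
def PCompletion.map {D D' : Type*} [CommRing D] [CommRing D'] (g : D →+* D') :
    PCompletion p D →+* PCompletion p D' :=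
  have hle : ∀ n, Ideal.span {(p : D)} ^ n ≤ (Ideal.span {(p : D')} ^ n).comap g := fun n => by
    rw [← Ideal.map_le_iff_le_comap, Ideal.map_pow, Ideal.map_span, Set.image_singleton,
      map_natCast]
  AdicCompletion.liftRingHom _
    (fun n => (Ideal.quotientMap _ g (hle n)).comp
      (AdicCompletion.evalₐ (Ideal.span {(p : D)}) n : _ →+* _))
    (by
      intro m n hmn
      ext x
      obtain ⟨y, hy⟩ := Ideal.Quotient.mk_surjective
        (AdicCompletion.evalₐ (Ideal.span {(p : D)}) n x)
      have h2 : AdicCompletion.evalₐ (Ideal.span {(p : D)}) m x = Ideal.Quotient.mk _ y :=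
        evalₐ_of_le _ hmn x y hy
      simp only [RingHom.comp_apply, RingHom.coe_coe, h2, ← hy]
      rfl)

end Completion

/-! ### The tilt, `A_cris` and the maps `F` and `β` -/

section Acris

variable (p : ℕ) [hp : Fact p.Prime] (C : Type*) [CommRing C] [Algebra (ZMod p) C]

/-- The Frobenius endomorphism `x ↦ x ^ p` of an `𝔽_p`-algebra. -/
def frob : C →ₐ[ZMod p] C where
  toFun x := x ^ p
  map_one' := one_pow _
  map_mul' x y := mul_pow x y p
  map_zero' := zero_pow hp.1.ne_zero
  map_add' x y := by
    have := map_add (FiniteField.frobeniusAlgHom (ZMod p) C) x y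
    simpa [FiniteField.coe_frobeniusAlgHom, ZMod.card] using this
  commutes' r := by rw [← map_pow, ZMod.pow_card]

theorem frob_apply (x : C) : frob p C x = x ^ p := rfl

/-- `C^♭`: the inverse limit of `C` along Frobenius, that is the ring of sequences
`(c_0, c_1, …)` with `c_{n+1} ^ p = c_n`. -/
def Tilt : Subalgebra (ZMod p) (ℕ → C) where
  carrier := {c | ∀ n, c (n + 1) ^ p = c n}
  mul_mem' ha hb n := by rw [Pi.mul_apply, mul_pow, ha, hb, Pi.mul_apply]
  add_mem' {a b} ha hb n := by
    have := map_add (frob p C) (a (n + 1)) (b (n + 1))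
    simp only [frob_apply] at this
    rw [Pi.add_apply, this, ha, hb, Pi.add_apply]
  algebraMap_mem' r n := by
    change algebraMap (ZMod p) C r ^ p = algebraMap (ZMod p) C r
    rw [← map_pow, ZMod.pow_card]

variable {C} in
/-- The projection `ν_n : C^♭ → C`, `(c_0, c_1, …) ↦ c_n`. -/
def nu (n : ℕ) : Tilt p C →ₐ[ZMod p] C :=
  (Pi.evalAlgHom (ZMod p) (fun _ : ℕ => C) n).comp (Tilt p C).val

/-- The homomorphism `W(C^♭) → C` induced by `ν_0`. -/
def theta : WittVector p (Tilt p C) →+* C :=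
  (nu p (C := C) 0 : Tilt p C →+* C).comp constantCoeff

/-- The PD hull of `W(C^♭) → C` (including the condition `γ_n(p) = p ^ n / n!`). -/
abbrev AcrisHull : Type _ := PDHull (zpToWitt p (Tilt p C)) (RingHom.ker (theta p C))

/-- Fontaine's ring `A_cris(C)`: the `p`-adic completion of the PD hull of `W(C^♭) → C`. -/
abbrev ACris : Type _ := PCompletion p (AcrisHull p C)

/-- The canonical homomorphism `W(C^♭) → A_cris(C)`. -/
def ofWitt : WittVector p (Tilt p C) →+* ACris p C :=
  (algebraMap (AcrisHull p C) (ACris p C)).comp (PDHull.of _ _)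

section Functoriality

variable {C} {C' : Type*} [CommRing C'] [Algebra (ZMod p) C']

/-- Functoriality of `C ↦ C^♭`. -/
def Tilt.map (g : C →ₐ[ZMod p] C') : Tilt p C →ₐ[ZMod p] Tilt p C' where
  toFun c := ⟨fun n => g (c.1 n), fun n => by rw [← map_pow, c.2 n]⟩
  map_one' := Subtype.ext <| funext fun _ => map_one g
  map_mul' _ _ := Subtype.ext <| funext fun _ => map_mul g _ _
  map_zero' := Subtype.ext <| funext fun _ => map_zero g
  map_add' _ _ := Subtype.ext <| funext fun _ => map_add g _ _
  commutes' r := Subtype.ext <| funext fun _ => g.commutes r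

variable {p} in
theorem map_zpToWitt {A A' : Type*} [CommRing A] [Algebra (ZMod p) A] [CommRing A']
    [Algebra (ZMod p) A'] (g : A →ₐ[ZMod p] A') (a : ℤ_[p]) :
    WittVector.map (g : A →+* A') (zpToWitt p A a) = zpToWitt p A' a := by
  ext n
  simp [zpToWitt, WittVector.map_coeff]

variable {p} in
theorem theta_map (g : C →ₐ[ZMod p] C') (x : WittVector p (Tilt p C)) :
    theta p C' (WittVector.map (Tilt.map p g : Tilt p C →+* Tilt p C') x) =
      g (theta p C x) := rfl

/-- Functoriality of `C ↦ A_cris(C)`. -/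
def ACris.map (g : C →ₐ[ZMod p] C') : ACris p C →+* ACris p C' :=
  PCompletion.map p <| PDHull.map
    (WittVector.map (Tilt.map p g : Tilt p C →+* Tilt p C'))
    (fun x hx => by
      rw [RingHom.mem_ker] at hx ⊢
      rw [theta_map, hx, map_zero])
    (fun a => map_zpToWitt _ a)

end Functoriality

/-- The endomorphism `F` of `A_cris(C)` induced by the Frobenius of `C`. -/
def ACris.frobenius : ACris p C →+* ACris p C := ACris.map p (frob p C)

theorem map_nu_mem (x : RingHom.ker (theta p C)) :
    WittVector.map (nu p (C := C) 0 : Tilt p C →+* C) x.1 ∈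
      RingHom.ker (constantCoeff : WittVector p C →+* C) := x.2

/-- The PD homomorphism from the PD hull of `W(C^♭) → C` to `W(C)` that extends
`W(ν_0) : W(C^♭) → W(C)`; here `Ker (W(C) → C)` carries its canonical PD structure. -/
def betaHull : AcrisHull p C →+* WittVector p C :=
  PDHull.lift (WittVector.map (nu p (C := C) 0 : Tilt p C →+* C))
    (fun n x => (wittDividedPowers p C).dpow n (WittVector.map (nu p (C := C) 0 : Tilt p C →+* C) x.1))
    (fun x => (wittDividedPowers p C).dpow_zero (map_nu_mem p C x))
    (fun x => (wittDividedPowers p C).dpow_one (map_nu_mem p C x))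
    (fun n r x => by
      rw [← (wittDividedPowers p C).dpow_mul (map_nu_mem p C x), ← map_mul]; rfl)
    (fun m n x => by
      rw [(wittDividedPowers p C).mul_dpow (map_nu_mem p C x), nsmul_eq_mul])
    (fun n x y => by
      rw [← (wittDividedPowers p C).dpow_add (map_nu_mem p C x) (map_nu_mem p C y),
        ← map_add]; rfl)
    (fun n a ha x hx => by rw [hx, map_zpToWitt, map_zpToWitt, wittDpow_zpToWitt n ha])

theorem betaHull_of (x : WittVector p (Tilt p C)) :
    betaHull p C (PDHull.of _ _ x) = WittVector.map (nu p (C := C) 0 : Tilt p C →+* C) x :=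
  PDHull.lift_of ..

theorem betaHull_dp (n : ℕ) (x : RingHom.ker (theta p C)) :
    betaHull p C (PDHull.dp _ _ n x) =
      (wittDividedPowers p C).dpow n (WittVector.map (nu p (C := C) 0 : Tilt p C →+* C) x.1) :=
  PDHull.lift_dp ..

variable {p C} in
theorem truncate_p_pow (n : ℕ) : WittVector.truncate n ((p : WittVector p C) ^ n) = 0 := by
  have h : ∀ n : ℕ, (p : WittVector p C) ^ n = verschiebung^[n] 1 := by
    intro n
    induction n with
    | zero => simp
    | succ n ih =>
      have e := verschiebung_mul_frobenius (1 : WittVector p C) ((p : WittVector p C) ^ n)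
      rw [map_pow, map_natCast, one_mul, verschiebung_one] at e
      rw [Function.iterate_succ_apply', ← ih, pow_succ', e]
  rw [← RingHom.mem_ker, mem_ker_truncate]
  intro i hi
  rw [h]
  exact iterate_verschiebung_coeff_eq_zero _ hi

/-- The homomorphism `β_n : A_cris(C) → A_cris(C) / p ^ n → W_n(C)`. -/
def betaTrunc (n : ℕ) : ACris p C →+* TruncatedWittVector p n C :=
  (Ideal.Quotient.lift (Ideal.span {(p : AcrisHull p C)} ^ n)
    ((WittVector.truncate n).comp (betaHull p C)) (by
      intro d hd
      rw [Ideal.span_singleton_pow, Ideal.mem_span_singleton] at hd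
      obtain ⟨e, rfl⟩ := hd
      rw [map_mul, map_pow, map_natCast, ← map_natCast (WittVector.truncate n), ← map_pow,
        truncate_p_pow, zero_mul])).comp
    (AdicCompletion.evalₐ (Ideal.span {(p : AcrisHull p C)}) n : _ →+* _)

theorem betaTrunc_compat (k₁ k₂ : ℕ) (hk : k₁ ≤ k₂) :
    (TruncatedWittVector.truncate hk).comp (betaTrunc p C k₂) = betaTrunc p C k₁ := by
  ext1 x
  obtain ⟨y, hy⟩ := Ideal.Quotient.mk_surjective
    (AdicCompletion.evalₐ (Ideal.span {(p : AcrisHull p C)}) k₂ x)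
  have h2 : AdicCompletion.evalₐ (Ideal.span {(p : AcrisHull p C)}) k₁ x =
      Ideal.Quotient.mk _ y :=
    evalₐ_of_le _ hk x y hy
  simp only [betaTrunc, RingHom.comp_apply, RingHom.coe_coe, h2, ← hy, Ideal.Quotient.lift_mk,
    TruncatedWittVector.truncate_wittVector_truncate]

/-- The canonical homomorphism `β : A_cris(C) → W(C) = lim W_n(C)`, the continuous extension of
the PD homomorphism `betaHull`. -/
def beta : ACris p C →+* WittVector p C :=
  WittVector.lift (fun n => betaTrunc p C n) (betaTrunc_compat p C)

theorem beta_algebraMap (d : AcrisHull p C) :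
    beta p C (algebraMap (AcrisHull p C) (ACris p C) d) = betaHull p C d := by
  rw [← sub_eq_zero, ← Ideal.mem_bot, ← TruncatedWittVector.iInf_ker_truncate, Ideal.mem_iInf]
  intro n
  rw [RingHom.mem_ker, map_sub, sub_eq_zero, beta, truncate_lift, betaTrunc,
    RingHom.comp_apply, RingHom.coe_coe, AlgHom.commutes]
  rfl

end Acris

/-! ### Dieudonné modules, good algebras and the two groups of homomorphisms -/

section Dieudonne

universe u

variable (p : ℕ) [hp : Fact p.Prime]

/-- A module over the Dieudonné ring `D_k`: a `W(k)`-module with additive operators `F`, `V` such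
that `F a = σ(a) F`, `V σ(a) = a V` for `a ∈ W(k)`, and `F V = V F = p`, where `σ` is the
Frobenius automorphism of `W(k)`. -/
class DieudonneModule (k : Type*) [CommRing k] (N : Type*) [AddCommGroup N]
    [Module (WittVector p k) N] where
  F : N →+ N
  V : N →+ N
  F_smul : ∀ (a : WittVector p k) (x : N), F (a • x) = WittVector.frobenius a • F x
  V_smul : ∀ (a : WittVector p k) (x : N), V (WittVector.frobenius a • x) = a • V x
  F_V : ∀ x : N, F (V x) = (p : ℕ) • x
  V_F : ∀ x : N, V (F x) = (p : ℕ) • x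

/-- The monoid `ℤ_+[1/p]` of non-negative elements of `ℤ[1/p]`. -/
def PExp : AddSubmonoid NNRat where
  carrier := {q | ∃ m a : ℕ, q * (p : NNRat) ^ m = a}
  zero_mem' := ⟨0, 0, by simp⟩
  add_mem' := by
    rintro x y ⟨m, a, h⟩ ⟨n, b, h'⟩
    refine ⟨m + n, a * p ^ n + b * p ^ m, ?_⟩
    push_cast
    rw [← h, ← h', pow_add]
    ring

/-- The element `1 ∈ ℤ_+[1/p]`. -/
def PExp.one : PExp p := ⟨1, 0, 1, by simp⟩

/-- `B[x_1^{p^{-∞}}, …, x_n^{p^{-∞}}]`: finite sums `∑ b_α x^α` with `α ∈ ℤ_+[1/p]^n`. -/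
abbrev PerfPoly (B : Type*) [CommRing B] (n : ℕ) : Type _ :=
  AddMonoidAlgebra B (Fin n → PExp p)

/-- The variable `x_i`. -/
def PerfPoly.X (B : Type*) [CommRing B] {n : ℕ} (i : Fin n) : PerfPoly p B n :=
  AddMonoidAlgebra.single (Pi.single i (PExp.one p)) 1

/-- A `k`-algebra is good if it is isomorphic to
`B[x_1^{p^{-∞}}, …, x_n^{p^{-∞}}]/(x_1, …, x_n)` for some perfect `k`-algebra `B` and some `n`. -/
def IsGood (k : Type*) [CommRing k] (C : Type u) [CommRing C] [Algebra k C] : Prop :=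
  ∃ (B : Type u) (_ : CommRing B) (_ : Algebra k B) (_ : PerfectRing B p) (n : ℕ),
    Nonempty (C ≃ₐ[k] (PerfPoly p B n ⧸ Ideal.span (Set.range (PerfPoly.X p B (n := n)))))

variable (k : Type*) [Field k] [CharP k p] [PerfectRing k p]
  (C : Type*) [CommRing C] [Algebra (ZMod p) C] [Algebra k C]

/-- The unique lift `k → C^♭` of `k → C`, namely `a ↦ (a^{1/p^n})_n`. -/
def toTilt : k →+* Tilt p C where
  toFun a := ⟨fun n => algebraMap k C ((frobeniusEquiv k p).symm^[n] a), fun n => by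
    rw [← map_pow, Function.iterate_succ_apply', frobeniusEquiv_symm_pow_p]⟩
  map_one' := Subtype.ext <| funext fun n => by simp [iterate_map_one]
  map_mul' a b := Subtype.ext <| funext fun n => by simp [iterate_map_mul]
  map_zero' := Subtype.ext <| funext fun n => by simp [iterate_map_zero]
  map_add' a b := Subtype.ext <| funext fun n => by simp [iterate_map_add]

/-- The structure map `W(k) → W(C^♭) → A_cris(C)`. -/
def wittToACris : WittVector p k →+* ACris p C :=
  (ofWitt p C).comp (WittVector.map (toTilt p k C))

/-- The structure map `W(k) → W(C)`. -/
def wittToWitt : WittVector p k →+* WittVector p C := WittVector.map (algebraMap k C)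

variable (N : Type*) [AddCommGroup N] [Module (WittVector p k) N] [DieudonneModule p k N]

/-- `Hom_{W(k)[F]}(N, A_cris(C))`. -/
def homACris : AddSubgroup (N →ₛₗ[wittToACris p k C] ACris p C) where
  carrier := {f | ∀ x, f (DieudonneModule.F p k x) = ACris.frobenius p C (f x)}
  add_mem' hf hg x := by simp only [LinearMap.add_apply, hf x, hg x, map_add]
  zero_mem' x := by simp
  neg_mem' hf x := by simp only [LinearMap.neg_apply, hf x, map_neg]

/-- `Hom_{D_k}(N, W(C))`, where `F` and `V` act on `W(C)` as the Witt vector Frobenius and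
Verschiebung. -/
def homWitt : AddSubgroup (N →ₛₗ[wittToWitt p k C] WittVector p C) where
  carrier := {f | (∀ x, f (DieudonneModule.F p k x) = WittVector.frobenius (f x)) ∧
    ∀ x, f (DieudonneModule.V p k x) = WittVector.verschiebung (f x)}
  add_mem' hf hg := ⟨fun x => by simp only [LinearMap.add_apply, hf.1 x, hg.1 x, map_add],
    fun x => by simp only [LinearMap.add_apply, hf.2 x, hg.2 x, map_add]⟩
  zero_mem' := ⟨fun x => by simp, fun x => by simp⟩
  neg_mem' hf := ⟨fun x => by simp only [LinearMap.neg_apply, hf.1 x, map_neg],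
    fun x => by simp only [LinearMap.neg_apply, hf.2 x, map_neg]⟩

/-- `V : N → N` is topologically nilpotent for the `p`-adic topology: `V ^ m → 0`. -/
def VTopNilpotent : Prop :=
  ∀ n : ℕ, ∀ᶠ m in Filter.atTop, ∀ x : N, ∃ y : N,
    (DieudonneModule.V p k : N →+ N)^[m] x = (p ^ n : ℕ) • y

end Dieudonne

end Acris

end

/-! Write A for `ACris p C`. Three facts about A carry the proof: A has no `p`-torsion; if `β y`
lies in `V W(C)` then `F y = p z` for some `z`; and whenever `F y = p z`, then `β y = V (β z)`.

From these the theorem follows by successive approximation. If `f` commutes with `F`, then `F (f (V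
x)) = p (f x)`, so `β ∘ f` commutes with `V`. Conversely, given `h : N → W(C)` commuting with `V`,
lift it to a semilinear `f`, which is possible because `N` is free, and iterate `f ↦ p⁻¹ F f V`.
Each iterate still lifts `h`. On `Ker β` the operator `F^m` is divisible by `p^m`, and `V^m N ⊂ p^j
N` for large `m`, so the iterates converge (`exists_lift`); the same estimate gives uniqueness
(`eq_zero_of_comp_eq_zero`).

The relation between `F` and `β` rests on the ideal `divIdeal` of those `y` for which `F y = p z`
and `β y = V (β z)` for some `z`. It contains `p` and all `γ_n(x)` with `n ≥ 1` (`dp_mem_divIdeal`),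
so A is the sum of `divIdeal` and the image of `W(C^♭)`, and only elements of `W(C^♭)` have to be
examined.

Torsion-freeness uses the presentation of a good algebra. The PD hull is compared with the ring of
sums `∑ a_α x^α / ⌊α⌋!`, `a_α ∈ W(B)`, completed `p`-adically. Modulo `p` the hull is spanned by
divided monomials (`AcrisHull.dividedMonomials_surjective`), and these stay independent in the
comparison ring. Hence the comparison map is injective modulo `p`
(`dvd_of_dvd_acrisHullToPDComplete`), and torsion-freeness passes from the target to A. -/

namespace Acris

/-! ### Limits in `p`-adically complete rings. -/

section PadicLimits

variable {A : Type*} [CommRing A] (q : A)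

theorem exists_limit_of_dvd_sub [IsAdicComplete (Ideal.span {q}) A] (u : ℕ → A)
    (M : ℕ → ℕ) (hM : ∀ j, ∀ m ≥ M j, q ^ j ∣ u (m + 1) - u m) :
    ∃ L, ∀ j, ∀ m, (∀ m' ≥ m, q ^ j ∣ u (m' + 1) - u m') → q ^ j ∣ L - u m := by
  have key : ∀ j m, (∀ m' ≥ m, q ^ j ∣ u (m' + 1) - u m') → ∀ m' ≥ m, q ^ j ∣ u m' - u m := by
    intro j m h m' hm
    induction m', hm using Nat.le_induction with
    | base => simp
    | succ i hi ih => simpa using dvd_add (h i hi) ih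
  -- Partial sums turn `M` into a monotone modulus of convergence, so that the subsequence `u (M'
  -- j)` is Cauchy in the form required by `IsPrecomplete`.
  let M' : ℕ → ℕ := fun j => ∑ i ∈ Finset.range (j + 1), M i
  have hMM : ∀ j, M j ≤ M' j := fun j =>
    Finset.single_le_sum (f := M) (fun _ _ => Nat.zero_le _) (Finset.self_mem_range_succ j)
  have hmono : Monotone M' := fun a b hab =>
    Finset.sum_le_sum_of_subset (Finset.range_mono (by omega))
  obtain ⟨L, hL⟩ := IsPrecomplete.prec (I := Ideal.span {q}) (M := A) inferInstance
    (f := fun j => u (M' j)) (fun {m n} hmn => by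
      rw [SModEq.sub_mem, smul_eq_mul, Ideal.mul_top, Ideal.span_singleton_pow,
        Ideal.mem_span_singleton, ← neg_sub, dvd_neg]
      exact key m (M' m) (fun m' hm' => hM m m' ((hMM m).trans hm')) _ (hmono hmn))
  refine ⟨L, fun j m h => ?_⟩
  have h1 := hL j
  rw [SModEq.sub_mem, smul_eq_mul, Ideal.mul_top, Ideal.span_singleton_pow,
        Ideal.mem_span_singleton] at h1
  have h2 := key j m h (max m (M' j)) (le_max_left _ _)
  have h3 := key j (M' j) (fun m' hm' => hM j m' ((hMM j).trans hm')) (max m (M' j))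
    (le_max_right _ _)
  have := dvd_sub (dvd_sub h2 h3) h1
  have e : u (max m (M' j)) - u m - (u (max m (M' j)) - u (M' j)) - (u (M' j) - L) = L - u m := by
    ring
  rwa [e] at this

theorem eq_zero_of_forall_pow_dvd [IsAdicComplete (Ideal.span {q}) A] {x : A}
    (h : ∀ j, q ^ j ∣ x) : x = 0 := by
  refine IsHausdorff.haus (I := Ideal.span {q}) inferInstance x fun j => ?_
  rw [SModEq.zero, smul_eq_mul, Ideal.mul_top, Ideal.span_singleton_pow, Ideal.mem_span_singleton]
  exact h j

end PadicLimits

/-! ### Abstract lifting along `β`, by iterating `p⁻¹ Φ f V`. -/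

section Comparison

open DieudonneModule

variable {p : ℕ} [hp : Fact p.Prime] {k : Type*} [Field k] [CharP k p] [PerfectRing k p]
  {N : Type*} [AddCommGroup N] [Module (WittVector p k) N] [DieudonneModule p k N]
  {A W : Type*} [CommRing A] [CommRing W] {s : WittVector p k →+* A} {t : WittVector p k →+* W}
  {Φ : A →+* A} {β : A →+* W} {φ : W →+* W} {v : W →+ W}

/-- One step `f ↦ p⁻¹ Φ f V` of the iteration. Division by `p` is unique in a torsion-free ring, so
the pointwise quotients form a semilinear map; injectivity of `v` shows that they still lift `h`. -/
theorem exists_step (htf : ∀ y : A, (p : A) * y = 0 → y = 0)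
    (hs : ∀ a, Φ (s a) = s (WittVector.frobenius a))
    (hv : Function.Injective v)
    (hker : ∀ y w, β y = v w → ∃ z, Φ y = p * z ∧ β y = v (β z))
    (h : N → W) (hh : ∀ x, h (V p k x) = v (h x))
    (f : N →ₛₗ[s] A) (hf : ∀ x, β (f x) = h x) :
    ∃ g : N →ₛₗ[s] A, (∀ x, β (g x) = h x) ∧ ∀ x, Φ (f (V p k x)) = p * g x := by
  have key : ∀ x, ∃ z, Φ (f (V p k x)) = p * z ∧ β (f (V p k x)) = v (β z) := fun x =>
    hker _ (h x) (by rw [hf, hh])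
  choose g hg hg' using key
  have cancel : ∀ a b : A, (p : A) * a = p * b → a = b := fun a b hab =>
    sub_eq_zero.1 (htf _ (by rw [mul_sub, hab, sub_self]))
  refine ⟨⟨⟨g, fun x y => cancel _ _ ?_⟩, fun a x => cancel _ _ ?_⟩, fun x => hv ?_, hg⟩
  · rw [mul_add, ← hg, ← hg, ← hg, map_add, map_add, map_add]
  -- Frobenius is bijective on `W(k)`: writing `a = σ(b)`, the scalar leaves `V` as `b`, and `Φ`
  -- turns `s b` back into `s a`.
  · obtain ⟨b, rfl⟩ := (WittVector.frobenius_bijective p k).2 a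
    simp only
    rw [← hg, V_smul, LinearMap.map_smulₛₗ, smul_eq_mul, smul_eq_mul, map_mul, hs, hg]
    ring
  · change v (β (g x)) = _
    rw [← hg', hf, hh]

theorem iterate_map_natCast (n m : ℕ) : Φ^[m] (n : A) = n :=
  Function.iterate_fixed (map_natCast Φ n) m

/-- The case `w = 0` of `hker` can be iterated: `v` is injective, so the quotient of `Φ y` by `p` is
again in the kernel of `β`. -/
theorem exists_iterate_eq_pow_mul {p : ℕ} (hv : Function.Injective v)
    (hker : ∀ y w, β y = v w → ∃ z, Φ y = p * z ∧ β y = v (β z)) (m : ℕ) :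
    ∀ y, β y = 0 → ∃ z, Φ^[m] y = p ^ m * z ∧ β z = 0 := by
  induction m with
  | zero => exact fun y hy => ⟨y, by simp, hy⟩
  | succ m ih =>
    intro y hy
    obtain ⟨z, hz, hz'⟩ := hker y 0 (by rw [hy, map_zero])
    obtain ⟨w, hw, hw'⟩ := ih z (hv (by rw [← hz', hy, map_zero]))
    refine ⟨w, ?_, hw'⟩
    rw [Function.iterate_succ_apply, hz, iterate_map_mul, hw, iterate_map_natCast]
    ring

/-- Existence of the lift, by successive approximation. -/
theorem exists_lift [IsAdicComplete (Ideal.span {(p : A)}) A]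
    (hV : VTopNilpotent p k N) (htf : ∀ y : A, (p : A) * y = 0 → y = 0)
    (hs : ∀ a, Φ (s a) = s (WittVector.frobenius a))
    (hv : Function.Injective v)
    (hker : ∀ y w, β y = v w → ∃ z, Φ y = p * z ∧ β y = v (β z))
    (hW : ∀ w : W, (∀ j, (p : W) ^ j ∣ w) → w = 0)
    (h : N → W) (hh : ∀ x, h (V p k x) = v (h x))
    (f : N →ₛₗ[s] A) (hf : ∀ x, β (f x) = h x) :
    ∃ g : N →ₛₗ[s] A, (∀ x, β (g x) = h x) ∧ ∀ x, g (F p k x) = Φ (g x) := by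
  choose T hT using fun f : {f : N →ₛₗ[s] A // ∀ x, β (f x) = h x} =>
    exists_step htf hs hv hker h hh f.1 f.2
  let u : ℕ → {f : N →ₛₗ[s] A // ∀ x, β (f x) = h x} := fun n =>
    Nat.rec ⟨f, hf⟩ (fun _ f => ⟨T f, (hT f).1⟩) n
  have hu : ∀ n x, Φ ((u n).1 (V p k x)) = p * (u (n + 1)).1 x := fun n => (hT (u n)).2
  have htfp : ∀ (m : ℕ) (y : A), (p : A) ^ m * y = 0 → y = 0 := by
    intro m
    induction m with
    | zero => simp
    | succ m ih => exact fun y hy => ih _ (htf _ (by rw [← hy]; ring))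
  -- This unwinds the recursion `Φ u_n V = p u_{n+1}` down to the first difference, which takes
  -- values in the kernel of `β`.
  have hd : ∀ m x, (p : A) ^ m * ((u (m + 1)).1 x - (u m).1 x) =
      Φ^[m] ((u 1).1 ((V p k : N →+ N)^[m] x) - (u 0).1 ((V p k : N →+ N)^[m] x)) := by
    intro m
    induction m with
    | zero => simp
    | succ m ih =>
      intro x
      rw [Function.iterate_succ_apply', Function.iterate_succ_apply, ← ih, map_mul, map_pow,
        map_natCast, map_sub, hu m x, hu (m + 1) x]
      ring
  have hev : ∀ j, ∃ M, ∀ m ≥ M, ∀ x, (p : A) ^ j ∣ (u (m + 1)).1 x - (u m).1 x := by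
    intro j
    obtain ⟨M, hM⟩ := Filter.eventually_atTop.1 (hV j)
    refine ⟨M, fun m hm x => ?_⟩
    -- With `V^m x = p^j y`, the right side of `hd` is `p^j Φ^m(…)`, and `Φ^m` contributes another
    -- `p^m`, which cancels the one on the left.
    obtain ⟨y, hy⟩ := hM m hm x
    obtain ⟨z, hz, -⟩ := exists_iterate_eq_pow_mul (Φ := Φ) hv hker m
      ((u 1).1 y - (u 0).1 y) (by rw [map_sub, (u 1).2, (u 0).2, sub_self])
    have := hd m x
    rw [hy, map_nsmul, map_nsmul, ← smul_sub, nsmul_eq_mul, iterate_map_mul,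
      iterate_map_natCast, hz] at this
    refine ⟨z, sub_eq_zero.1 (htfp m _ ?_)⟩
    rw [mul_sub, this]
    push_cast
    ring
  choose M hM using hev
  choose L hL using fun x => exists_limit_of_dvd_sub (p : A) (fun m => (u m).1 x) M
    (fun j m hm => hM j m hm x)
  have hL' : ∀ j, ∀ m ≥ M j, ∀ x, (p : A) ^ j ∣ L x - (u m).1 x := fun j m hm x =>
    hL x j m fun m' hm' => hM j m' (hm.trans hm') x
  let g : N →ₛₗ[s] A := ⟨⟨L, fun x y => by
      refine sub_eq_zero.1 (eq_zero_of_forall_pow_dvd (p : A) fun j => ?_)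
      have h1 := hL' j (M j) le_rfl
      convert dvd_sub (h1 (x + y)) (dvd_add (h1 x) (h1 y)) using 1
      rw [map_add]; ring⟩, fun a x => by
      refine sub_eq_zero.1 (eq_zero_of_forall_pow_dvd (p : A) fun j => ?_)
      have h1 := hL' j (M j) le_rfl
      convert dvd_sub (h1 (a • x)) (dvd_mul_of_dvd_right (h1 x) (s a)) using 1
      rw [LinearMap.map_smulₛₗ]; simp only [smul_eq_mul]; ring⟩
  have hg : ∀ x, Φ (L (V p k x)) = p * L x := by
    refine fun x => sub_eq_zero.1 (eq_zero_of_forall_pow_dvd (p : A) fun j => ?_)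
    have h1 := hL' j (M j) le_rfl (V p k x)
    have h2 := hL' j (M j + 1) (by omega) x
    have h3 := map_dvd Φ h1
    rw [map_sub, map_pow, map_natCast, hu] at h3
    convert dvd_sub h3 (dvd_mul_of_dvd_right h2 (p : A)) using 1
    ring
  refine ⟨g, fun x => sub_eq_zero.1 (hW _ fun j => ?_), fun x => sub_eq_zero.1 (htf _ ?_)⟩
  -- No continuity of `β` is needed: every `u n` lifts `h` exactly, so `β (g x) - h x` is divisible
  -- by all powers of `p`.
  · have h1 := map_dvd β (hL' j (M j) le_rfl x)
    rwa [map_sub, (u (M j)).2, map_pow, map_natCast] at h1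
  -- Evaluating `Φ g V = p g` at `F x` and using `V F = p` gives `p Φ(g x) = p g(F x)`.
  · have h1 := hg (F p k x)
    rw [V_F] at h1
    have h2 : L (p • x) = p • L x := map_nsmul g p x
    rw [h2, nsmul_eq_mul, map_mul, map_natCast] at h1
    rw [mul_sub]
    exact sub_eq_zero.2 h1.symm

omit [CharP k p] [PerfectRing k p] in
-- Since `F V = p`, one has `p^m f = Φ^m f V^m`. If `V^m x = p^j y`, then `Φ^m (f y)` is divisible
-- by `p^m`, so `p^j` divides `f x`.
theorem eq_zero_of_comp_eq_zero [IsAdicComplete (Ideal.span {(p : A)}) A]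
    (hV : VTopNilpotent p k N) (htf : ∀ y : A, (p : A) * y = 0 → y = 0)
    (hv : Function.Injective v)
    (hker : ∀ y w, β y = v w → ∃ z, Φ y = p * z ∧ β y = v (β z))
    (f : N →ₛₗ[s] A) (hf : ∀ x, β (f x) = 0) (hF : ∀ x, f (F p k x) = Φ (f x)) (x : N) :
    f x = 0 := by
  have htfp : ∀ (m : ℕ) (y : A), (p : A) ^ m * y = 0 → y = 0 := by
    intro m
    induction m with
    | zero => simp
    | succ m ih => exact fun y hy => ih _ (htf _ (by rw [← hy]; ring))
  have hd : ∀ m x, (p : A) ^ m * f x = Φ^[m] (f ((V p k : N →+ N)^[m] x)) := by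
    intro m
    induction m with
    | zero => simp
    | succ m ih =>
      intro x
      rw [Function.iterate_succ_apply', Function.iterate_succ_apply, ← ih, map_mul, map_pow,
        map_natCast, ← hF, F_V, map_nsmul, nsmul_eq_mul]
      ring
  refine eq_zero_of_forall_pow_dvd (p : A) fun j => ?_
  obtain ⟨m, hm⟩ := (hV j).exists
  obtain ⟨y, hy⟩ := hm x
  obtain ⟨z, hz, -⟩ := exists_iterate_eq_pow_mul (Φ := Φ) hv hker m (f y) (hf y)
  have := hd m x
  rw [hy, map_nsmul, nsmul_eq_mul, iterate_map_mul, iterate_map_natCast, hz] at this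
  refine ⟨z, sub_eq_zero.1 (htfp m _ ?_)⟩
  rw [mul_sub, this]
  push_cast
  ring

omit [CharP k p] [PerfectRing k p] [DieudonneModule p k N] in
theorem exists_semilinear_lift [Module.Free (WittVector p k) N] [Module.Finite (WittVector p k) N]
    (hβ : Function.Surjective β) (hst : ∀ a, β (s a) = t a) (h : N →ₛₗ[t] W) :
    ∃ f : N →ₛₗ[s] A, ∀ x, β (f x) = h x := by
  let b := Module.Free.chooseBasis (WittVector p k) N
  choose a ha using fun i => hβ (h (b i))
  refine ⟨⟨⟨fun x => ∑ i, s (b.repr x i) * a i, fun x y => ?_⟩, fun c x => ?_⟩, fun x => ?_⟩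
  · simp [add_mul, Finset.sum_add_distrib]
  · simp [Finset.mul_sum, mul_assoc]
  · have e : h x = ∑ i, t (b.repr x i) * h (b i) := by
      conv_lhs => rw [← b.sum_repr x, map_sum]
      exact Finset.sum_congr rfl fun i _ => by rw [LinearMap.map_smulₛₗ, smul_eq_mul]
    simp [ha, hst, e]

end Comparison

end Acris

namespace Acris

open WittVector Finset

/-! ### Torsion in `ℤ_p`-algebras, PD hulls and `p`-adic completions. -/

section Torsion

variable {p : ℕ} [hp : Fact p.Prime] {R : Type*} [CommRing R]

/-- In `ℤ_p` a nonzero integer is a unit times a power of `p`. -/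
theorem natCast_mul_eq_zero (z : ℤ_[p] →+* R) (h : ∀ y : R, (p : R) * y = 0 → y = 0) {n : ℕ}
    (hn : n ≠ 0) {y : R} (hy : (n : R) * y = 0) : y = 0 := by
  have hn' : (n : ℤ_[p]) ≠ 0 := by exact_mod_cast hn
  have hpow : ∀ (m : ℕ) (y : R), (p : R) ^ m * y = 0 → y = 0 := by
    intro m
    induction m with
    | zero => simp
    | succ m ih => exact fun y hy => ih _ (h _ (by rw [← hy]; ring))
  have e := congrArg z (PadicInt.unitCoeff_spec hn')
  rw [map_natCast, map_mul, map_pow, map_natCast] at e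
  rw [e, mul_comm (z _), mul_assoc] at hy
  have h1 := hpow _ _ hy
  have hu : IsUnit (z (PadicInt.unitCoeff hn' : ℤ_[p])) := (Units.isUnit _).map z
  exact (hu.mul_right_eq_zero).1 h1

theorem natCast_mul_cancel (z : ℤ_[p] →+* R) (h : ∀ y : R, (p : R) * y = 0 → y = 0) {n : ℕ}
    (hn : n ≠ 0) {x y : R} (hxy : (n : R) * x = n * y) : x = y :=
  sub_eq_zero.1 (natCast_mul_eq_zero z h hn (by rw [mul_sub, hxy, sub_self]))

variable (p) in
-- For `n ≥ 1` the element `p * pdCoeff p n` is `γ_n(p)`; this form keeps the factor `p` visible.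
theorem factorial_mul_p_mul_pdCoeff {n : ℕ} (hn : n ≠ 0) :
    (n.factorial : ℤ_[p]) * (p * pdCoeff p n) = p ^ n := by
  apply Subtype.ext
  have h1 : (n.factorial : ℚ_[p]) ≠ 0 := by exact_mod_cast Nat.factorial_ne_zero _
  obtain ⟨m, rfl⟩ := Nat.exists_eq_succ_of_ne_zero hn
  simp only [PadicInt.coe_mul, PadicInt.coe_natCast, PadicInt.coe_pow, coe_pdCoeff,
    Nat.succ_sub_one, Nat.succ_eq_add_one] at h1 ⊢
  field_simp
  ring

end Torsion

namespace PDHull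

variable {p : ℕ} [hp : Fact p.Prime] {R : Type*} [CommRing R] {z : ℤ_[p] →+* R} {J : Ideal R}

theorem induction {P : PDHull z J → Prop} (h_of : ∀ r, P (of z J r))
    (h_add : ∀ a b, P a → P b → P (a + b)) (h_dp : ∀ a n x, P a → P (a * dp z J n x))
    (d : PDHull z J) : P d := by
  obtain ⟨d, rfl⟩ := Ideal.Quotient.mk_surjective (I := pdRelations z J) d
  induction d using DividedPowerAlgebra.induction_on with
  | C a => exact h_of a
  | add f g hf hg =>
    exact (congrArg P (map_add (Ideal.Quotient.mk (pdRelations z J)) f g)).mpr (h_add _ _ hf hg)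
  | dp f n m hf =>
    exact (congrArg P (map_mul (Ideal.Quotient.mk (pdRelations z J)) f _)).mpr (h_dp _ n m hf)

theorem ringHom_ext {A : Type*} [CommRing A] {f g : PDHull z J →+* A}
    (h_of : ∀ r, f (of z J r) = g (of z J r)) (h_dp : ∀ n x, f (dp z J n x) = g (dp z J n x)) :
    f = g := by
  ext1 d
  induction d using PDHull.induction with
  | h_of r => exact h_of r
  | h_add a b ha hb => rw [map_add, map_add, ha, hb]
  | h_dp a n x ha => rw [map_mul, map_mul, ha, h_dp]

theorem factorial_mul_dp (n : ℕ) (x : J) :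
    (n.factorial : PDHull z J) * dp z J n x = of z J x ^ n := by
  rw [← dp_one, dp, dp]
  refine Eq.trans ?_ (congrArg (Ideal.Quotient.mk (pdRelations z J))
    (DividedPowerAlgebra.natFactorial_mul_dp_eq (R := R) n x))
  rw [map_mul, map_natCast]
  rfl

variable {R' : Type*} [CommRing R'] {z' : ℤ_[p] →+* R'} {J' : Ideal R'}
  (g : R →+* R') (hg : ∀ x ∈ J, g x ∈ J') (hz : ∀ a, g (z a) = z' a)

theorem map_of (r : R) : map g hg hz (of z J r) = of z' J' (g r) := lift_of ..

theorem map_dp (n : ℕ) (x : J) : map g hg hz (dp z J n x) = dp z' J' n ⟨g x, hg x x.2⟩ :=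
  lift_dp ..

end PDHull

namespace PCompletion

variable {p : ℕ} {D D' : Type*} [CommRing D] [CommRing D']

variable (p D) in
theorem fg_span : (Ideal.span {(p : D)}).FG := ⟨{(p : D)}, by simp⟩

theorem map_algebraMap_span : (Ideal.span {(p : D)}).map (algebraMap D (PCompletion p D)) =
    Ideal.span {(p : PCompletion p D)} := by
  rw [Ideal.map_span, Set.image_singleton, map_natCast]

instance isAdicComplete :
    IsAdicComplete (Ideal.span {(p : PCompletion p D)}) (PCompletion p D) := by
  rw [← map_algebraMap_span, IsAdicComplete.map_algebraMap_iff]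
  exact AdicCompletion.isAdicComplete (fg_span p D)

theorem dvd_iff_evalOneₐ_eq_zero (y : PCompletion p D) :
    (p : PCompletion p D) ∣ y ↔ AdicCompletion.evalOneₐ (Ideal.span {(p : D)}) y = 0 := by
  rw [← Ideal.mem_span_singleton, ← map_algebraMap_span]
  exact (SetLike.ext_iff.1 (AdicCompletion.ker_evalOneₐ_eq_map _ (fg_span p D)) y).symm

theorem exists_eq_add (y : PCompletion p D) :
    ∃ (d : D) (y' : PCompletion p D), y = algebraMap D (PCompletion p D) d + p * y' := by
  obtain ⟨d, hd⟩ := Ideal.Quotient.mk_surjective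
    (AdicCompletion.evalOneₐ (Ideal.span {(p : D)}) y)
  have : (p : PCompletion p D) ∣ y - algebraMap D (PCompletion p D) d := by
    rw [dvd_iff_evalOneₐ_eq_zero, map_sub, ← hd, sub_eq_zero]
    rfl
  obtain ⟨y', hy'⟩ := this
  exact ⟨d, y', by rw [← hy']; ring⟩

theorem exists_eq_add_pow (n : ℕ) (y : PCompletion p D) :
    ∃ (d : D) (y' : PCompletion p D), y = algebraMap D (PCompletion p D) d + p ^ n * y' := by
  induction n with
  | zero => exact ⟨0, y, by simp⟩
  | succ n ih =>
    obtain ⟨d, y', rfl⟩ := ih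
    obtain ⟨d', y'', rfl⟩ := exists_eq_add y'
    refine ⟨d + p ^ n * d', y'', ?_⟩
    rw [map_add, map_mul, map_pow, map_natCast]
    ring

theorem dvd_algebraMap_iff (d : D) :
    (p : PCompletion p D) ∣ algebraMap D (PCompletion p D) d ↔ (p : D) ∣ d := by
  rw [dvd_iff_evalOneₐ_eq_zero, ← Ideal.mem_span_singleton, ← Ideal.Quotient.eq_zero_iff_mem]
  rfl

theorem pow_dvd_of_pow_dvd_algebraMap (n : ℕ) {d : D}
    (h : (p : PCompletion p D) ^ n ∣ algebraMap D (PCompletion p D) d) : (p : D) ^ n ∣ d := by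
  obtain ⟨y, hy⟩ := h
  have := congrArg (AdicCompletion.evalₐ (Ideal.span {(p : D)}) n) hy
  rw [map_mul, map_pow, map_natCast, AlgHom.commutes] at this
  rw [← Ideal.mem_span_singleton, ← Ideal.span_singleton_pow, ← Ideal.Quotient.eq_zero_iff_mem]
  refine this.trans ?_
  have h0 : (p : D ⧸ Ideal.span {(p : D)} ^ n) ^ n = 0 := by
    rw [← map_natCast (Ideal.Quotient.mk _), ← map_pow, Ideal.Quotient.eq_zero_iff_mem]
    exact Ideal.pow_mem_pow (Ideal.mem_span_singleton_self _) n
  rw [h0, zero_mul]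

theorem map_algebraMap (g : D →+* D') (d : D) :
    map p g (algebraMap D (PCompletion p D) d) = algebraMap D' (PCompletion p D') (g d) := by
  refine AdicCompletion.ext_evalₐ fun n => ?_
  refine AdicCompletion.evalₐ_liftRingHom _ _ ?_ n _
  intro m n hmn
  ext x
  obtain ⟨y, hy⟩ := Ideal.Quotient.mk_surjective
    (AdicCompletion.evalₐ (Ideal.span {(p : D)}) n x)
  have h2 : AdicCompletion.evalₐ (Ideal.span {(p : D)}) m x = Ideal.Quotient.mk _ y :=
    evalₐ_of_le _ hmn x y hy
  simp only [RingHom.comp_apply, RingHom.coe_coe, h2, ← hy]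
  rfl

/-- If `D → O` is injective modulo `p` and `O` has no `p`-torsion, then the `p`-adic completion
of `D` has no `p`-torsion. -/
theorem eq_zero_of_p_mul_eq_zero {O : Type*} [CommRing O] (g : D →+* O)
    (hO : ∀ y : O, (p : O) * y = 0 → y = 0) (hg : ∀ d, (p : O) ∣ g d → (p : D) ∣ d)
    (y : PCompletion p D) (hy : (p : PCompletion p D) * y = 0) : y = 0 := by
  -- `g` need not be injective, but its kernel is infinitely `p`-divisible: if `g (p d') = 0`, then
  -- `g d' = 0` as well.
  have hker : ∀ n d, g d = 0 → (p : D) ^ n ∣ d := by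
    intro n
    induction n with
    | zero => simp
    | succ n ih =>
      intro d hd
      obtain ⟨d', rfl⟩ := hg d (by simp [hd])
      rw [map_mul, map_natCast] at hd
      rw [pow_succ']
      exact mul_dvd_mul_left _ (ih d' (hO _ hd))
  refine eq_zero_of_forall_pow_dvd (p : PCompletion p D) fun n => ?_
  obtain ⟨d, y', rfl⟩ := exists_eq_add_pow n y
  -- Modulo `p^n` one may replace `y` by `d ∈ D`; then `p y = 0` says that `p d` lies in `p^{n+1}`
  -- times the completion, hence in `p^{n+1} D`.
  have h1 : (p : D) ^ (n + 1) ∣ p * d := by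
    refine pow_dvd_of_pow_dvd_algebraMap (n + 1) ⟨-y', ?_⟩
    rw [map_mul, map_natCast, ← sub_eq_zero, ← hy]
    ring
  obtain ⟨d', hd'⟩ := h1
  have h2 : g (d - p ^ n * d') = 0 := by
    refine hO _ ?_
    rw [← map_natCast g, ← map_mul, mul_sub, hd', pow_succ', mul_assoc, sub_self, map_zero]
  have h3 := dvd_add (hker n _ h2) (Dvd.intro _ rfl : (p : D) ^ n ∣ p ^ n * d')
  rw [sub_add_cancel] at h3
  have h4 := map_dvd (algebraMap D (PCompletion p D)) h3
  rw [map_pow, map_natCast] at h4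
  exact dvd_add h4 (Dvd.intro _ rfl)

end PCompletion

end Acris

namespace Acris

open WittVector Finset

/-! ### The tilt is perfect; `β` on Witt vectors. -/

section Tilt

variable (p : ℕ) [hp : Fact p.Prime] (C : Type*) [CommRing C] [Algebra (ZMod p) C]

theorem Tilt.ext {c d : Tilt p C} (h : ∀ n, nu p n c = nu p n d) : c = d :=
  Subtype.ext (funext h)

variable {C} in
theorem nu_succ_pow (n : ℕ) (c : Tilt p C) : nu p (n + 1) c ^ p = nu p n c := c.2 n

instance Tilt.charP [CharP C p] : CharP (Tilt p C) p := by
  have : Nontrivial C := CharP.nontrivial_of_char_ne_one hp.1.ne_one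
  exact charP_of_injective_algebraMap (algebraMap (ZMod p) (Tilt p C)).injective p

/-- The `p`-th root of an element of the tilt. -/
def Tilt.root (c : Tilt p C) : Tilt p C := ⟨fun n => c.1 (n + 1), fun n => c.2 (n + 1)⟩

variable {C} in
theorem nu_root (n : ℕ) (c : Tilt p C) : nu p n (Tilt.root p C c) = nu p (n + 1) c := rfl

theorem Tilt.root_pow (c : Tilt p C) : Tilt.root p C c ^ p = c :=
  Tilt.ext p C fun n => by rw [map_pow, nu_root, nu_succ_pow]

instance Tilt.perfectRing : PerfectRing (Tilt p C) p where
  bijective_frobenius := by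
    refine ⟨fun c d h => Tilt.ext p C fun n => ?_, fun c => ⟨_, Tilt.root_pow p C c⟩⟩
    have h' : c ^ p = d ^ p := h
    rw [← nu_succ_pow, ← nu_succ_pow p n d, ← map_pow, ← map_pow, h']

theorem ofWitt_eq (r : WittVector p (Tilt p C)) :
    ofWitt p C r = algebraMap (AcrisHull p C) (ACris p C) (PDHull.of _ _ r) := rfl

theorem beta_ofWitt (r : WittVector p (Tilt p C)) :
    beta p C (ofWitt p C r) = WittVector.map (nu p (C := C) 0 : Tilt p C →+* C) r := by
  rw [ofWitt_eq, beta_algebraMap, betaHull_of]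

theorem beta_ofWitt_zpToWitt (a : ℤ_[p]) :
    beta p C (ofWitt p C (zpToWitt p _ a)) = zpToWitt p C a := by
  rw [beta_ofWitt, map_zpToWitt]

variable {p C} in
theorem teichmuller_mem_ker {c : Tilt p C} (hc : nu p 0 c = 0) :
    teichmuller p c ∈ RingHom.ker (theta p C) := by
  rw [RingHom.mem_ker, theta, RingHom.comp_apply, constantCoeff_apply, teichmuller_coeff_zero]
  exact hc

theorem map_nu_teichmuller {c : Tilt p C} (hc : nu p 0 c = 0) :
    WittVector.map (nu p (C := C) 0 : Tilt p C →+* C) (teichmuller p c) = 0 := by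
  rw [map_teichmuller, RingHom.coe_coe, hc, teichmuller_zero]

end Tilt

/-! ### Divisibility of `F` by `p` on `A_cris` and its relation with `β`. -/

section Key

variable (p : ℕ) [hp : Fact p.Prime] (C : Type*) [CommRing C] [Algebra (ZMod p) C] [CharP C p]

theorem map_tilt_frob (r : WittVector p (Tilt p C)) :
    WittVector.map (Tilt.map p (frob p C) : Tilt p C →+* Tilt p C) r = frobenius r := by
  rw [frobenius_eq_map_frobenius]
  rfl

theorem theta_frobenius (x : RingHom.ker (theta p C)) :
    frobenius x.1 ∈ RingHom.ker (theta p C) := by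
  rw [RingHom.mem_ker, ← map_tilt_frob, theta_map, x.2, map_zero]

theorem ACris.frobenius_ofWitt (r : WittVector p (Tilt p C)) :
    ACris.frobenius p C (ofWitt p C r) = ofWitt p C (WittVector.frobenius r) := by
  rw [ofWitt_eq, ACris.frobenius, ACris.map, PCompletion.map_algebraMap, PDHull.map_of,
    map_tilt_frob, ofWitt_eq]

theorem ACris.frobenius_dp (n : ℕ) (x : RingHom.ker (theta p C)) :
    ACris.frobenius p C (algebraMap (AcrisHull p C) (ACris p C) (PDHull.dp _ _ n x)) =
      algebraMap (AcrisHull p C) (ACris p C)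
        (PDHull.dp _ _ n ⟨WittVector.frobenius x.1, theta_frobenius p C x⟩) := by
  rw [ACris.frobenius, ACris.map, PCompletion.map_algebraMap, PDHull.map_dp]
  congr 3
  exact map_tilt_frob p C x.1

omit [Algebra (ZMod p) C] in
-- In characteristic `p` one has `p = V F`, so multiples of `p^{i+1}` have zero coefficients up to
-- index `i`.
theorem pow_p_dvd_eq_zero {w : WittVector p C} (h : ∀ j, (p : WittVector p C) ^ j ∣ w) :
    w = 0 := by
  ext i
  obtain ⟨u, rfl⟩ := h (i + 1)
  rw [mul_comm, mul_pow_charP_coeff_zero _ (Nat.lt_succ_self i), zero_coeff]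

theorem frobenius_wittDpow (n : ℕ) {w : WittVector p C}
    (hw : w ∈ RingHom.ker (constantCoeff : WittVector p C →+* C)) :
    wittDpow n (frobenius w) = frobenius (wittDpow n w) := by
  obtain ⟨a, rfl⟩ := exists_eq_V hw
  have e : frobenius (verschiebung a) = verschiebung (frobenius a) := by
    rw [frobenius_verschiebung, verschiebung_frobenius]
  rw [e]
  rcases eq_or_ne n 0 with rfl | hn
  · rw [wittDpow_zero_V, wittDpow_zero_V, map_one]
  · rw [wittDpow_V hn, wittDpow_V hn, map_mul, frobenius_zpToWitt, frobenius_verschiebung,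
      ← map_pow, verschiebung_frobenius]

theorem beta_frobenius (y : ACris p C) :
    beta p C (ACris.frobenius p C y) = frobenius (beta p C y) := by
  have h : ∀ d : AcrisHull p C, beta p C (ACris.frobenius p C (algebraMap _ (ACris p C) d)) =
      frobenius (beta p C (algebraMap _ (ACris p C) d)) := by
    refine fun d => RingHom.congr_fun (PDHull.ringHom_ext
      (f := (beta p C).comp ((ACris.frobenius p C).comp (algebraMap _ (ACris p C))))
      (g := (WittVector.frobenius).comp ((beta p C).comp (algebraMap _ (ACris p C))))
      (fun r => ?_) (fun n x => ?_)) d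
    · change beta p C (ACris.frobenius p C (ofWitt p C r)) = frobenius (beta p C (ofWitt p C r))
      rw [ACris.frobenius_ofWitt, beta_ofWitt, beta_ofWitt, map_frobenius']
    · simp only [RingHom.comp_apply]
      rw [ACris.frobenius_dp, beta_algebraMap, beta_algebraMap, betaHull_dp, betaHull_dp,
        map_frobenius']
      exact frobenius_wittDpow p C n (map_nu_mem p C x)
  -- The PD hull is dense in `A_cris` and `W(C)` is `p`-adically separated, so the identity extends
  -- from the hull.
  refine sub_eq_zero.1 (pow_p_dvd_eq_zero p C fun j => ?_)
  obtain ⟨d, y', rfl⟩ := PCompletion.exists_eq_add_pow j y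
  simp only [map_add, map_mul, map_pow, map_natCast, h]
  exact ⟨beta p C (ACris.frobenius p C y') - frobenius (beta p C y'), by ring⟩

/-- The elements `y` of `A_cris(C)` such that `F y = p z` for some `z` with `β y = V (β z)`. -/
def divIdeal : Ideal (ACris p C) where
  carrier := {y | ∃ z, ACris.frobenius p C y = p * z ∧ beta p C y = verschiebung (beta p C z)}
  zero_mem' := ⟨0, by simp⟩
  add_mem' := by
    rintro y y' ⟨z, h1, h2⟩ ⟨z', h1', h2'⟩
    exact ⟨z + z', by rw [map_add, h1, h1', mul_add], by rw [map_add, h2, h2', map_add, map_add]⟩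
  smul_mem' := by
    rintro a y ⟨z, h1, h2⟩
    refine ⟨ACris.frobenius p C a * z, ?_, ?_⟩
    · rw [smul_eq_mul, map_mul, h1]; ring
    · rw [smul_eq_mul, map_mul, map_mul, h2, beta_frobenius, mul_comm (beta p C a),
        ← verschiebung_mul_frobenius, mul_comm]

theorem p_mem_divIdeal : (p : ACris p C) ∈ divIdeal p C :=
  ⟨1, by simp, by rw [map_one, map_natCast, verschiebung_one]⟩

theorem exists_eq_teichmuller_add (r : WittVector p (Tilt p C)) :
    ∃ w, r = teichmuller p (r.coeff 0) + p * w := by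
  have : r - teichmuller p (r.coeff 0) ∈ Ideal.span {(p : WittVector p (Tilt p C))} := by
    rw [mem_span_p_iff_coeff_zero_eq_zero]
    change constantCoeff (r - teichmuller p (r.coeff 0)) = 0
    rw [map_sub, constantCoeff_apply, constantCoeff_apply, teichmuller_coeff_zero, sub_self]
  obtain ⟨w, hw⟩ := Ideal.mem_span_singleton.1 this
  exact ⟨w, by rw [← hw]; ring⟩

/-- For `x` in the kernel, `F x = p u` with `β u` known, and then `F γ_n(x) = γ_n(p u) = p
(p^{n-1}/n!) u^n`. The formula `γ_n(V a) = (p^{n-1}/n!) V(a^n)` is exactly what makes `β γ_n(x)`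
match. -/
theorem dp_mem_divIdeal (htf : ∀ y : ACris p C, (p : ACris p C) * y = 0 → y = 0) {n : ℕ}
    (hn : n ≠ 0) (x : RingHom.ker (theta p C)) :
    algebraMap (AcrisHull p C) (ACris p C) (PDHull.dp _ _ n x) ∈ divIdeal p C := by
  obtain ⟨x, hx⟩ := x
  obtain ⟨w, hw⟩ := exists_eq_teichmuller_add p C x
  set c := x.coeff 0 with hc
  have hc0 : nu p 0 c = 0 := hx
  let i : RingHom.ker (theta p C) := ⟨teichmuller p c, teichmuller_mem_ker hc0⟩
  let ι := algebraMap (AcrisHull p C) (ACris p C)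
  -- With `x = [c] + p w`, `F x = [c]^p + p F(w)` and `[c]^p = p! γ_p([c])`; `u` is the quotient by
  -- `p`. Since `β` kills `[c]` and hence `γ_p([c])`, `β u` is the image of `F w`.
  let u : AcrisHull p C := PDHull.of _ _ (frobenius w) +
    ((p - 1).factorial : AcrisHull p C) * PDHull.dp _ _ p i
  have hFx : frobenius x = teichmuller p c ^ p + p * frobenius w := by
    conv_lhs => rw [hw]
    rw [map_add, map_mul, map_natCast, ← map_tilt_frob, map_teichmuller, ← map_pow]
    rfl
  have hu : PDHull.of _ _ (frobenius x) = (p : AcrisHull p C) * u := by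
    rw [hFx, map_add, map_mul, map_natCast, map_pow]
    have := PDHull.factorial_mul_dp (z := zpToWitt p (Tilt p C)) p i
    rw [← this, mul_add, ← mul_assoc, ← Nat.cast_mul, Nat.mul_factorial_pred hp.1.ne_zero]
    ring
  have hβu : beta p C (ι u) = frobenius (WittVector.map (nu p (C := C) 0 : Tilt p C →+* C) w) := by
    rw [beta_algebraMap, map_add, map_mul, betaHull_dp, betaHull_of, map_frobenius',
      map_nu_teichmuller p C hc0, (wittDividedPowers p C).dpow_eval_zero hp.1.ne_zero, mul_zero,
      add_zero]
  have hβx : WittVector.map (nu p (C := C) 0 : Tilt p C →+* C) x =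
      verschiebung (beta p C (ι u)) := by
    rw [hβu, verschiebung_frobenius]
    conv_lhs => rw [hw]
    rw [map_add, map_nu_teichmuller p C hc0, map_mul, map_natCast, zero_add, mul_comm]
  let z : ℤ_[p] →+* ACris p C := (ofWitt p C).comp (zpToWitt p _)
  refine ⟨z (pdCoeff p n) * ι u ^ n, ?_, ?_⟩
  -- Multiplying by `n!` reduces the formula for `F γ_n(x)` to `F(x)^n = p^n u^n`.
  · refine natCast_mul_cancel z htf (Nat.factorial_ne_zero n) ?_
    rw [ACris.frobenius_dp, ← map_natCast (algebraMap (AcrisHull p C) (ACris p C)), ← map_mul,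
      PDHull.factorial_mul_dp, hu, map_pow, map_mul, map_natCast, map_natCast, mul_pow]
    have := congrArg z (factorial_mul_p_mul_pdCoeff p hn)
    simp only [map_mul, map_natCast, map_pow] at this
    rw [← this]
    ring
  · rw [beta_algebraMap, betaHull_dp, map_mul, map_pow]
    change wittDpow n (WittVector.map (nu p (C := C) 0 : Tilt p C →+* C) x) =
      verschiebung (beta p C (ofWitt p C (zpToWitt p _ (pdCoeff p n))) * _)
    rw [hβx, wittDpow_V hn, beta_ofWitt_zpToWitt, zpToWitt_mul_verschiebung]

/-- Modulo `divIdeal` all generators `γ_n(x)` with `n ≥ 1` and all multiples of `p` vanish, so only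
`W(C^♭)` is left. -/
theorem exists_sub_mem_divIdeal (htf : ∀ y : ACris p C, (p : ACris p C) * y = 0 → y = 0)
    (y : ACris p C) : ∃ r, y - ofWitt p C r ∈ divIdeal p C := by
  have h : ∀ d : AcrisHull p C, ∃ r, algebraMap _ (ACris p C) d - ofWitt p C r ∈ divIdeal p C := by
    intro d
    induction d using PDHull.induction with
    | h_of r => exact ⟨r, by rw [ofWitt_eq, sub_self]; exact zero_mem _⟩
    | h_add a b ha hb =>
      obtain ⟨r, hr⟩ := ha
      obtain ⟨r', hr'⟩ := hb
      refine ⟨r + r', ?_⟩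
      convert add_mem hr hr' using 1
      rw [map_add, map_add]; ring
    | h_dp a n x ha =>
      rcases eq_or_ne n 0 with rfl | hn
      · rwa [PDHull.dp_zero, mul_one]
      · refine ⟨0, ?_⟩
        rw [map_zero, sub_zero, map_mul]
        exact Ideal.mul_mem_left _ _ (dp_mem_divIdeal p C htf hn x)
  obtain ⟨d, y', rfl⟩ := PCompletion.exists_eq_add y
  obtain ⟨r, hr⟩ := h d
  refine ⟨r, ?_⟩
  convert add_mem hr (Ideal.mul_mem_right y' _ (p_mem_divIdeal p C)) using 1
  ring

theorem ofWitt_mem_divIdeal (htf : ∀ y : ACris p C, (p : ACris p C) * y = 0 → y = 0)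
    {r : WittVector p (Tilt p C)} (hr : theta p C r = 0) : ofWitt p C r ∈ divIdeal p C := by
  have := dp_mem_divIdeal p C htf one_ne_zero ⟨r, hr⟩
  rwa [PDHull.dp_one] at this

/-- Modulo `divIdeal`, `y` is the image of some `r ∈ W(C^♭)`. As `β` maps `divIdeal` into `V W(C)`,
the zeroth coefficient of `β y` is `θ(r)`, which is zero; then `r` itself is in the ideal. -/
theorem exists_of_beta_eq_verschiebung
    (htf : ∀ y : ACris p C, (p : ACris p C) * y = 0 → y = 0) (y : ACris p C) (w : WittVector p C)
    (h : beta p C y = verschiebung w) :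
    ∃ z, ACris.frobenius p C y = p * z ∧ beta p C y = verschiebung (beta p C z) := by
  obtain ⟨r, hr⟩ := exists_sub_mem_divIdeal p C htf y
  have : theta p C r = 0 := by
    obtain ⟨z, -, hz⟩ := hr
    have e : constantCoeff (beta p C (ofWitt p C r)) = 0 := by
      rw [map_sub, h, sub_eq_iff_eq_add] at hz
      have := congrArg constantCoeff hz
      rw [map_add, constantCoeff_apply, constantCoeff_apply, verschiebung_coeff_zero,
        verschiebung_coeff_zero, zero_add] at this
      exact this.symm
    rwa [beta_ofWitt, constantCoeff_apply, map_coeff] at e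
  have h1 := add_mem hr (ofWitt_mem_divIdeal p C htf this)
  rw [sub_add_cancel] at h1
  exact h1

/-- Again `y` may be replaced by `r ∈ W(C^♭)`; now `p` divides `F r`, so `hF` gives `θ(r) = 0` and
`y ∈ divIdeal`. The quotient `z` is unique because there is no `p`-torsion. -/
theorem beta_eq_of_frobenius_eq (htf : ∀ y : ACris p C, (p : ACris p C) * y = 0 → y = 0)
    (hF : ∀ r, (p : ACris p C) ∣ ofWitt p C (WittVector.frobenius r) → theta p C r = 0)
    (y z : ACris p C) (h : ACris.frobenius p C y = p * z) :
    beta p C y = verschiebung (beta p C z) := by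
  obtain ⟨r, hr⟩ := exists_sub_mem_divIdeal p C htf y
  have : theta p C r = 0 := by
    obtain ⟨z', hz', -⟩ := hr
    refine hF r ⟨z - z', ?_⟩
    rw [map_sub, h, ACris.frobenius_ofWitt] at hz'
    rw [mul_sub, ← hz']; ring
  obtain ⟨z', h1, h2⟩ := add_mem hr (ofWitt_mem_divIdeal p C htf this)
  rw [sub_add_cancel] at h1 h2
  have : z = z' := sub_eq_zero.1 (htf _ (by rw [mul_sub, ← h, ← h1, sub_self]))
  rw [h2, this]

end Key

end Acris

namespace Acris

open WittVector Finset

theorem exists_addEquiv_of_bijective {G H : Type*} [AddGroup G] [AddGroup H] (e : G →+ H)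
    (he : Function.Bijective e) : ∃ e' : G ≃+ H, ∀ g, e' g = e g :=
  ⟨AddEquiv.ofBijective e he, fun _ => rfl⟩

/-! ### The isomorphism, given torsion-freeness and two further properties of `C`. -/

section Main

variable (p : ℕ) [hp : Fact p.Prime]
    (k : Type*) [Field k] [CharP k p] [PerfectRing k p]
    (N : Type*) [AddCommGroup N] [Module (WittVector p k) N] [DieudonneModule p k N]
    (C : Type*) [CommRing C] [Algebra (ZMod p) C] [Algebra k C]

theorem nu_toTilt (a : k) : nu p 0 (toTilt p k C a) = algebraMap k C a := rfl

theorem beta_wittToACris (a : WittVector p k) :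
    beta p C (wittToACris p k C a) = wittToWitt p k C a := by
  rw [wittToACris, RingHom.comp_apply, ofWitt_eq, beta_algebraMap, betaHull_of, wittToWitt]
  ext n
  simp only [map_coeff]
  exact nu_toTilt p k C _

theorem frobenius_wittToACris [CharP C p] (a : WittVector p k) :
    ACris.frobenius p C (wittToACris p k C a) = wittToACris p k C (WittVector.frobenius a) := by
  rw [wittToACris, RingHom.comp_apply, RingHom.comp_apply, ACris.frobenius_ofWitt, map_frobenius']

theorem beta_surjective (hnu : Function.Surjective (nu p (C := C) 0)) :
    Function.Surjective (beta p C) := fun w => by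
  obtain ⟨r, hr⟩ := WittVector.map_surjective (nu p (C := C) 0 : Tilt p C →+* C) hnu w
  exact ⟨ofWitt p C r, by rw [ofWitt_eq, beta_algebraMap, betaHull_of, hr]⟩

variable {p k N C} in
/-- Composition with `β : A_cris(C) → W(C)`. -/
noncomputable def betaComp (f : N →ₛₗ[wittToACris p k C] ACris p C) :
    N →ₛₗ[wittToWitt p k C] WittVector p C where
  toFun x := beta p C (f x)
  map_add' x y := by rw [map_add, map_add]
  map_smul' a x := by
    rw [LinearMap.map_smulₛₗ, smul_eq_mul, map_mul, beta_wittToACris, smul_eq_mul]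

variable {p k N C} in
omit [DieudonneModule p k N] in
theorem betaComp_apply (f : N →ₛₗ[wittToACris p k C] ACris p C) (x : N) :
    betaComp f x = beta p C (f x) := rfl

theorem betaComp_mem [CharP C p] (htf : ∀ y : ACris p C, (p : ACris p C) * y = 0 → y = 0)
    (hF : ∀ r, (p : ACris p C) ∣ ofWitt p C (WittVector.frobenius r) → theta p C r = 0)
    {f : N →ₛₗ[wittToACris p k C] ACris p C} (hf : f ∈ homACris p k C N) :
    betaComp f ∈ homWitt p k C N := by
  refine ⟨fun x => ?_, fun x => ?_⟩
  · rw [betaComp_apply, betaComp_apply, hf x, beta_frobenius]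
  -- Compatibility with `V` comes from `F (f (V x)) = f (F V x) = p f x`.
  · refine beta_eq_of_frobenius_eq p C htf hF _ _ ?_
    rw [← hf, DieudonneModule.F_V, map_nsmul, nsmul_eq_mul]

/-- Goodness of `C` enters only through `htf`, `hF` and `hnu`, which the rest of the file
establishes. -/
theorem exists_addEquiv [Module.Free (WittVector p k) N] [Module.Finite (WittVector p k) N]
    [CharP C p] (hV : VTopNilpotent p k N)
    (htf : ∀ y : ACris p C, (p : ACris p C) * y = 0 → y = 0)
    (hF : ∀ r, (p : ACris p C) ∣ ofWitt p C (WittVector.frobenius r) → theta p C r = 0)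
    (hnu : Function.Surjective (nu p (C := C) 0)) :
    ∃ e : homACris p k C N ≃+ homWitt p k C N,
      ∀ (f : homACris p k C N) (x : N), (e f).1 x = beta p C (f.1 x) := by
  have hker := exists_of_beta_eq_verschiebung p C htf
  have hadd : ∀ f g : N →ₛₗ[wittToACris p k C] ACris p C,
      betaComp (f + g) = betaComp f + betaComp g := fun f g =>
    LinearMap.ext fun x => by
      rw [LinearMap.add_apply, betaComp_apply, betaComp_apply, betaComp_apply,
        LinearMap.add_apply, map_add]
  obtain ⟨e, he⟩ : ∃ e : homACris p k C N →+ homWitt p k C N, ∀ f, (e f).1 = betaComp f.1 :=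
    ⟨AddMonoidHom.mk' (fun f => ⟨betaComp f.1, betaComp_mem p k N C htf hF f.2⟩)
      (fun f g => Subtype.ext (hadd f.1 g.1)), fun f => rfl⟩
  obtain ⟨e', he'⟩ : ∃ e' : homACris p k C N ≃+ homWitt p k C N, ∀ f, e' f = e f := by
    refine exists_addEquiv_of_bijective e ⟨?_, fun h => ?_⟩
    · refine (injective_iff_map_eq_zero e).2 fun f hf => Subtype.ext <| LinearMap.ext fun x => ?_
      refine eq_zero_of_comp_eq_zero hV htf (verschiebung_injective p C) hker f.1 (fun x => ?_)
        f.2 x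
      rw [← betaComp_apply, ← he, hf]
      rfl
    · obtain ⟨f, hf⟩ := exists_semilinear_lift (N := N) (beta_surjective p C hnu)
        (beta_wittToACris p k C) h.1
      obtain ⟨g, hg, hg'⟩ := exists_lift hV htf (frobenius_wittToACris p k C)
        (verschiebung_injective p C) hker (fun w hw => pow_p_dvd_eq_zero p C hw) h.1 h.2.2 f hf
      exact ⟨⟨g, hg'⟩, Subtype.ext ((he _).trans (LinearMap.ext hg))⟩
  exact ⟨e', fun f x => by rw [he', he, betaComp_apply]⟩

end Main

end Acris

namespace Acris

open WittVector Finset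

/-! ### Integral and fractional parts of exponents in `ℤ_+[1/p]`. -/

section Exponents

variable (p : ℕ) [hp : Fact p.Prime]

/-- Division by `p` in `ℤ_+[1/p]`. -/
def PExp.root (a : PExp p) : PExp p := ⟨a.1 / p, by
  obtain ⟨m, b, h⟩ := a.2
  refine ⟨m + 1, b, ?_⟩
  have : (p : NNRat) ≠ 0 := by exact_mod_cast hp.1.ne_zero
  rw [← h, pow_succ]
  field_simp⟩

theorem PExp.nsmul_root (a : PExp p) : p • PExp.root p a = a := by
  apply Subtype.ext
  have : (p : NNRat) ≠ 0 := by exact_mod_cast hp.1.ne_zero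
  simp only [AddSubmonoidClass.coe_nsmul, PExp.root, nsmul_eq_mul]
  field_simp

variable {p}

theorem PExp.nsmul_injective {a b : PExp p} (h : p • a = p • b) : a = b := by
  apply Subtype.ext
  have h0 : (p : NNRat) ≠ 0 := by exact_mod_cast hp.1.ne_zero
  have := congrArg Subtype.val h
  simpa [h0] using this

/-- The integral part of an element of `ℤ_+[1/p]`. -/
def PExp.floor (a : PExp p) : ℕ := ⌊a.1⌋₊

/-- The fractional part of an element of `ℤ_+[1/p]`. -/
def PExp.frac (a : PExp p) : PExp p := ⟨a.1 - PExp.floor a, by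
  obtain ⟨m, b, h⟩ := a.2
  refine ⟨m, b - PExp.floor a * p ^ m, ?_⟩
  rw [tsub_mul, h]
  push_cast
  rfl⟩

omit hp in
theorem PExp.frac_add_floor (a : PExp p) : PExp.frac a + PExp.floor a • PExp.one p = a := by
  apply Subtype.ext
  simp only [AddSubmonoid.coe_add, AddSubmonoidClass.coe_nsmul, PExp.frac, PExp.one, nsmul_eq_mul,
    mul_one]
  exact tsub_add_cancel_of_le (Nat.floor_le a.1.2)

omit hp in
theorem PExp.floor_add_nsmul (a : PExp p) (m : ℕ) :
    PExp.floor (a + m • PExp.one p) = PExp.floor a + m := by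
  simp only [PExp.floor, AddSubmonoid.coe_add, AddSubmonoidClass.coe_nsmul, PExp.one, nsmul_eq_mul,
    mul_one]
  exact Nat.floor_add_natCast a.1.2 m

omit hp in
theorem PExp.frac_add_nsmul (a : PExp p) (m : ℕ) :
    PExp.frac (a + m • PExp.one p) = PExp.frac a := by
  have h1 := PExp.frac_add_floor (a + m • PExp.one p)
  rw [PExp.floor_add_nsmul, add_nsmul, ← add_assoc] at h1
  have h2 := add_right_cancel h1
  conv_rhs at h2 => rw [← PExp.frac_add_floor a]
  exact add_right_cancel h2

omit hp in
theorem PExp.floor_add_floor_le (a b : PExp p) : PExp.floor a + PExp.floor b ≤ PExp.floor (a + b) :=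
  Nat.le_floor (by
    push_cast
    exact add_le_add (Nat.floor_le a.1.2) (Nat.floor_le b.1.2))

omit hp in
theorem PExp.exists_eq_add_one {a : PExp p} (h : PExp.floor a ≠ 0) : ∃ b, a = b + PExp.one p := by
  refine ⟨PExp.frac a + (PExp.floor a - 1) • PExp.one p, ?_⟩
  conv_lhs => rw [← PExp.frac_add_floor a]
  obtain ⟨m, hm⟩ := Nat.exists_eq_succ_of_ne_zero h
  rw [hm, Nat.succ_sub_one, Nat.succ_eq_add_one, succ_nsmul, add_assoc]

/-- Ensures that `⌊p a⌋!` is prime to `p` when `a < 1`. -/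
theorem PExp.floor_nsmul_lt {a : PExp p} (h : PExp.floor a = 0) : PExp.floor (p • a) < p := by
  rw [PExp.floor, Nat.floor_lt zero_le]
  rw [PExp.floor, Nat.floor_eq_zero] at h
  have h0 : (0 : NNRat) < p := by exact_mod_cast hp.1.pos
  simpa using (mul_lt_mul_iff_right₀ h0).2 h

omit hp in
theorem PExp.floor_one : PExp.floor (PExp.one p) = 1 := Nat.floor_one

omit hp in
theorem PExp.floor_zero : PExp.floor (0 : PExp p) = 0 := Nat.floor_zero

end Exponents

/-! ### Perfect polynomial rings and their monomial ideals. -/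

namespace PerfPoly

variable (p : ℕ) [hp : Fact p.Prime] (B : Type*) [CommRing B] (n : ℕ)

/-- The element `x_i^{1/p}`. -/
noncomputable def rootX (i : Fin n) : PerfPoly p B n :=
  AddMonoidAlgebra.single (Pi.single i (PExp.root p (PExp.one p))) 1

instance charP [CharP B p] : CharP (PerfPoly p B n) p :=
  charP_of_injective_ringHom (f := AddMonoidAlgebra.singleZeroRingHom)
    (AddMonoidAlgebra.single_right_injective) p

variable {p B n}

theorem rootX_pow (i : Fin n) : rootX p B n i ^ p = X p B i := by
  rw [rootX, AddMonoidAlgebra.single_pow, one_pow, X, ← Pi.single_smul, PExp.nsmul_root]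

omit hp in
-- Membership in a monomial ideal is tested on monomials, and `x_i` divides `x^α` exactly when `α i
-- ≥ 1`.
theorem mem_span_X_iff (q : PerfPoly p B n) :
    q ∈ Ideal.span (Set.range (X p B (n := n))) ↔
      ∀ α, q.coeff α ≠ 0 → ∃ i, PExp.floor (α i) ≠ 0 := by
  have e : Set.range (X p B (n := n)) = AddMonoidAlgebra.of' B (Fin n → PExp p) ''
      Set.range (fun i : Fin n => Pi.single i (PExp.one p)) := by
    rw [← Set.range_comp]; rfl
  rw [e, AddMonoidAlgebra.mem_ideal_span_of'_image]
  simp only [Finsupp.mem_support_iff, Set.exists_range_iff]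
  refine forall₂_congr fun α _ => exists_congr fun i => ⟨?_, fun h => ?_⟩
  · rintro ⟨d, rfl⟩
    have := PExp.floor_add_floor_le (d i) (PExp.one p)
    rw [PExp.floor_one] at this
    simp only [Pi.add_apply, Pi.single_eq_same]
    omega
  · obtain ⟨b, hb⟩ := PExp.exists_eq_add_one h
    refine ⟨Function.update α i b, ?_⟩
    ext1 j
    rcases eq_or_ne j i with rfl | hj
    · simp [hb]
    · simp [hj]

section Perfect

variable [CharP B p]

theorem coeff_pow (q : PerfPoly p B n) (α : Fin n → PExp p) :
    (q ^ p).coeff (p • α) = q.coeff α ^ p := by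
  classical
  induction q using AddMonoidAlgebra.induction_linear with
  | zero => simp [hp.1.ne_zero]
  | add f g hf hg =>
    rw [add_pow_char, AddMonoidAlgebra.coeff_add, Finsupp.add_apply, hf, hg,
      AddMonoidAlgebra.coeff_add, Finsupp.add_apply, add_pow_char]
  | single β b =>
    rw [AddMonoidAlgebra.single_pow, AddMonoidAlgebra.coeff_single,
      AddMonoidAlgebra.coeff_single, Finsupp.single_apply, Finsupp.single_apply]
    have : p • β = p • α ↔ β = α :=
      ⟨fun h => funext fun i => PExp.nsmul_injective (congrFun h i), fun h => by rw [h]⟩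
    simp only [this]
    split_ifs
    · rfl
    · rw [zero_pow hp.1.ne_zero]

variable [PerfectRing B p]

omit [CharP B p] in
theorem pow_eq_zero {b : B} (h : b ^ p = 0) : b = 0 :=
  PerfectRing.bijective_frobenius.injective (h.trans (zero_pow hp.1.ne_zero).symm)

instance perfectRing : PerfectRing (PerfPoly p B n) p where
  bijective_frobenius := by
    refine ⟨fun f g h => ?_, fun f => ?_⟩
    · ext α
      have h' : f ^ p = g ^ p := h
      have := congrArg (fun f : PerfPoly p B n => f.coeff (p • α)) h'
      simp only [coeff_pow] at this
      exact PerfectRing.bijective_frobenius.injective this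
    · induction f using AddMonoidAlgebra.induction_linear with
      | zero => exact ⟨0, zero_pow hp.1.ne_zero⟩
      | add f g hf hg =>
        obtain ⟨f', rfl⟩ := hf
        obtain ⟨g', rfl⟩ := hg
        exact ⟨f' + g', add_pow_char _ _ _⟩
      | single β b =>
        obtain ⟨c, hc⟩ := (PerfectRing.bijective_frobenius (R := B) (p := p)).surjective b
        refine ⟨AddMonoidAlgebra.single (fun i => PExp.root p (β i)) c, ?_⟩
        have e : p • (fun i => PExp.root p (β i)) = β :=
          funext fun i => PExp.nsmul_root p (β i)
        have hc' : c ^ p = b := hc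
        simp only [AddMonoidAlgebra.single_pow, e, hc']

/-- A monomial `x^α` of `q` gives the monomial `x^{pα}` of `q^p`, with nonzero coefficient as `B` is
perfect. Thus `p α_i ≥ 1` for some `i`, and `x_i^{1/p}` divides `x^α`. -/
theorem mem_span_rootX_of_pow_mem {q : PerfPoly p B n}
    (h : q ^ p ∈ Ideal.span (Set.range (X p B (n := n)))) :
    q ∈ Ideal.span (Set.range (rootX p B n)) := by
  have e : Set.range (rootX p B n) = AddMonoidAlgebra.of' B (Fin n → PExp p) ''
      Set.range (fun i : Fin n => Pi.single i (PExp.root p (PExp.one p))) := by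
    rw [← Set.range_comp]; rfl
  rw [e, AddMonoidAlgebra.mem_ideal_span_of'_image]
  simp only [Finsupp.mem_support_iff, Set.exists_range_iff]
  intro α hα
  obtain ⟨i, hi⟩ := (mem_span_X_iff _).1 h (p • α) (by
    rw [coeff_pow]; exact fun h => hα (pow_eq_zero h))
  obtain ⟨b, hb⟩ := PExp.exists_eq_add_one hi
  have hb' : α i = PExp.root p b + PExp.root p (PExp.one p) := by
    apply PExp.nsmul_injective
    rw [nsmul_add, PExp.nsmul_root, PExp.nsmul_root, ← hb]
    rfl
  refine ⟨i, Function.update α i (PExp.root p b), ?_⟩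
  ext1 j
  rcases eq_or_ne j i with rfl | hj
  · simp [hb']
  · simp [hj]

end Perfect

end PerfPoly

end Acris

noncomputable section

namespace Acris

open WittVector Finset

/-! ### Integers in `W(B)` and in its total ring of fractions. -/

section WittTorsion

variable (p : ℕ) [hp : Fact p.Prime] (B : Type*) [CommRing B] [CharP B p] [PerfectRing B p]

theorem witt_natCast_mul_eq_zero {m : ℕ} (hm : m ≠ 0) {w : WittVector p B}
    (h : (m : WittVector p B) * w = 0) :
    w = 0 := by
  let _ : Algebra (ZMod p) B := ZMod.algebra B p
  exact natCast_mul_eq_zero (zpToWitt p B)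
    (fun y hy => eq_zero_of_p_mul_eq_zero y (by rw [mul_comm, hy])) hm h

theorem isUnit_natCast_fractionRing {m : ℕ} (hm : m ≠ 0) :
    IsUnit (m : FractionRing (WittVector p B)) := by
  rw [← map_natCast (algebraMap (WittVector p B) (FractionRing (WittVector p B)))]
  exact IsLocalization.map_units (FractionRing (WittVector p B))
    (⟨m, mem_nonZeroDivisors_iff_right.2 fun w hw =>
      witt_natCast_mul_eq_zero p B hm (by rw [mul_comm, hw])⟩ : nonZeroDivisors (WittVector p B))

omit [CharP B p] [PerfectRing B p] in
theorem algebraMap_fractionRing_injective :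
    Function.Injective (algebraMap (WittVector p B) (FractionRing (WittVector p B))) :=
  IsLocalization.injective _ le_rfl

end WittTorsion

/-! ### The divided power polynomial ring and its coordinates modulo `p`. -/

section PDPoly

variable (p : ℕ) [hp : Fact p.Prime] {n : ℕ}

/-- The product of the factorials of the integral parts of a multi-exponent. -/
def factFloor (α : Fin n → PExp p) : ℕ := ∏ i, (PExp.floor (α i)).factorial

omit hp in
theorem factFloor_ne_zero (α : Fin n → PExp p) : factFloor p α ≠ 0 :=
  Finset.prod_ne_zero_iff.2 fun _ _ => Nat.factorial_ne_zero _

omit hp in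
-- This is what makes the sums `∑ a_α x^α / ⌊α⌋!` closed under multiplication: `i! j!` divides
-- `(i+j)!`, and the integral part is superadditive.
theorem factFloor_mul_dvd (α β : Fin n → PExp p) :
    factFloor p α * factFloor p β ∣ factFloor p (α + β) := by
  rw [factFloor, factFloor, factFloor, ← Finset.prod_mul_distrib]
  exact Finset.prod_dvd_prod_of_dvd _ _ fun i _ =>
    (Nat.factorial_mul_factorial_dvd_factorial_add _ _).trans
      (Nat.factorial_dvd_factorial (PExp.floor_add_floor_le (α i) (β i)))

omit hp in
theorem factFloor_zero : factFloor p (0 : Fin n → PExp p) = 1 :=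
  Finset.prod_eq_one fun i _ => by rw [Pi.zero_apply, PExp.floor_zero, Nat.factorial_zero]

variable (B : Type*) [CommRing B] (n)

/-- The coefficients of elements of the divided power polynomial ring. -/
abbrev PDCoeff : Type _ := AddMonoidAlgebra (FractionRing (WittVector p B)) (Fin n → PExp p)

/-- The additive group of the sums `∑ a_α x^α / ⌊α⌋!` with `a_α ∈ W(B)`. -/
def pdPolyAdd : AddSubgroup (PDCoeff p n B) where
  carrier := {f | ∀ α, ∃ w, (factFloor p α : FractionRing (WittVector p B)) * f.coeff α =
    algebraMap (WittVector p B) _ w}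
  zero_mem' α := ⟨0, by simp⟩
  add_mem' {f g} hf hg α := by
    obtain ⟨w, hw⟩ := hf α
    obtain ⟨w', hw'⟩ := hg α
    exact ⟨w + w', by rw [map_add, ← hw, ← hw', AddMonoidAlgebra.coeff_add, Finsupp.add_apply,
      mul_add]⟩
  neg_mem' {f} hf α := by
    obtain ⟨w, hw⟩ := hf α
    exact ⟨-w, by rw [map_neg, ← hw, AddMonoidAlgebra.coeff_neg, Finsupp.neg_apply, mul_neg]⟩

variable {p n B}

theorem single_mem_pdPolyAdd {α : Fin n → PExp p} {r : FractionRing (WittVector p B)}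
    {w : WittVector p B}
    (h : (factFloor p α : FractionRing (WittVector p B)) * r = algebraMap (WittVector p B) _ w) :
    AddMonoidAlgebra.single α r ∈ pdPolyAdd p n B := by
  classical
  intro β
  rw [AddMonoidAlgebra.coeff_single, Finsupp.single_apply]
  split_ifs with hβ
  · subst hβ
    exact ⟨w, h⟩
  · exact ⟨0, by simp⟩

variable (p n B) in
/-- The ring of the sums `∑ a_α x^α / ⌊α⌋!` with `a_α ∈ W(B)`. -/
def pdPoly : Subring (PDCoeff p n B) where
  __ := pdPolyAdd p n B
  one_mem' := single_mem_pdPolyAdd (w := 1) (by rw [factFloor_zero]; simp)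
  mul_mem' {f g} hf hg := by
    change f * g ∈ pdPolyAdd p n B
    rw [AddMonoidAlgebra.mul_def, Finsupp.sum]
    refine sum_mem fun α _ => sum_mem fun β _ => ?_
    obtain ⟨w, hw⟩ := hf α
    obtain ⟨w', hw'⟩ := hg β
    obtain ⟨m, hm⟩ := factFloor_mul_dvd p α β
    refine single_mem_pdPolyAdd (w := m * (w * w')) ?_
    rw [map_mul, map_mul, ← hw, ← hw', hm, map_natCast]
    push_cast
    ring

namespace PDPoly

variable (p n B) in
/-- The embedding of `W(B)`. -/
def const : WittVector p B →+* pdPoly p n B :=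
  (AddMonoidAlgebra.singleZeroRingHom.comp
    (algebraMap (WittVector p B) (FractionRing (WittVector p B)))).codRestrict (pdPoly p n B)
    fun w => single_mem_pdPolyAdd (w := w) (by
      rw [factFloor_zero, Nat.cast_one, one_mul])

variable (p n B) in
/-- The monomials `x^α`. -/
def monomial : Multiplicative (Fin n → PExp p) →* pdPoly p n B where
  toFun α := ⟨AddMonoidAlgebra.single α.toAdd 1,
    single_mem_pdPolyAdd (w := factFloor p α.toAdd) (by simp)⟩
  map_one' := rfl
  map_mul' α β := Subtype.ext (by simp [AddMonoidAlgebra.single_mul_single])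

theorem coe_const_mul_monomial (w : WittVector p B) (α : Fin n → PExp p) :
    ((const p n B w * monomial p n B (.ofAdd α) : pdPoly p n B) : PDCoeff p n B) =
      AddMonoidAlgebra.single α (algebraMap _ _ w) := by
  change AddMonoidAlgebra.single 0 _ * AddMonoidAlgebra.single α 1 = _
  rw [AddMonoidAlgebra.single_mul_single, zero_add, mul_one]

section Perfect

variable [CharP B p] [PerfectRing B p]

/-- The witness is the divided monomial `x^α / ⌊α⌋!`. -/
theorem exists_factFloor_mul (α : Fin n → PExp p) :
    ∃ e : pdPoly p n B, (factFloor p α : pdPoly p n B) * e = monomial p n B (.ofAdd α) ∧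
      ∀ w, ((const p n B w * e : pdPoly p n B) : PDCoeff p n B) =
        AddMonoidAlgebra.single α (algebraMap _ _ w * Ring.inverse (factFloor p α :
          FractionRing (WittVector p B))) := by
  have hu := isUnit_natCast_fractionRing p B (factFloor_ne_zero p α)
  refine ⟨⟨AddMonoidAlgebra.single α (Ring.inverse (factFloor p α)),
    single_mem_pdPolyAdd (w := 1) (by rw [Ring.mul_inverse_cancel _ hu, map_one])⟩,
    Subtype.ext ?_, fun w => ?_⟩
  · change (factFloor p α : PDCoeff p n B) * AddMonoidAlgebra.single α _ =
      AddMonoidAlgebra.single α 1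
    rw [AddMonoidAlgebra.natCast_def, AddMonoidAlgebra.single_mul_single, zero_add,
      Ring.mul_inverse_cancel _ hu]
  · change AddMonoidAlgebra.single 0 _ * AddMonoidAlgebra.single α _ = _
    rw [AddMonoidAlgebra.single_mul_single, zero_add]

theorem eq_zero_of_natCast_mul_eq_zero {m : ℕ} (hm : m ≠ 0) {f : pdPoly p n B}
    (h : (m : pdPoly p n B) * f = 0) : f = 0 := by
  apply Subtype.ext
  ext α
  have h1 : (m : PDCoeff p n B) * f.1 = 0 := congrArg Subtype.val h
  rw [← nsmul_eq_mul] at h1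
  have h2 : m • f.1.coeff α = 0 := congrArg (fun g : PDCoeff p n B => g.coeff α) h1
  rw [nsmul_eq_mul] at h2
  exact (isUnit_natCast_fractionRing p B hm).mul_right_eq_zero.1 h2

variable (p n B) in
/-- The map `∑ a_α x^α / ⌊α⌋! ↦ a_α`. -/
def wittCoeff (α : Fin n → PExp p) : pdPoly p n B →+ WittVector p B :=
  -- The chosen element is unique, because `W(B)` embeds in its ring of fractions; hence the choice
  -- is additive.
  AddMonoidHom.mk' (fun f => (f.2 α).choose) fun f g => by
    apply algebraMap_fractionRing_injective p B
    rw [map_add, ← ((f + g).2 α).choose_spec, ← (f.2 α).choose_spec, ← (g.2 α).choose_spec,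
      ← mul_add]
    rfl

omit [CharP B p] [PerfectRing B p] in
theorem algebraMap_wittCoeff (α : Fin n → PExp p) (f : pdPoly p n B) :
    algebraMap _ (FractionRing (WittVector p B)) (wittCoeff p n B α f) =
      factFloor p α * f.1.coeff α := ((f.2 α).choose_spec).symm

variable (p n B) in
/-- The map `∑ a_α x^α / ⌊α⌋! ↦ a_α mod p`. -/
def residue (α : Fin n → PExp p) : pdPoly p n B →+ B :=
  (constantCoeff : WittVector p B →+* B).toAddMonoidHom.comp (wittCoeff p n B α)

omit [CharP B p] [PerfectRing B p] in
theorem residue_eq {α : Fin n → PExp p} {f : pdPoly p n B} {w : WittVector p B}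
    (h : factFloor p α * f.1.coeff α = algebraMap _ (FractionRing (WittVector p B)) w) :
    residue p n B α f = constantCoeff w := by
  have : wittCoeff p n B α f = w :=
    algebraMap_fractionRing_injective p B ((algebraMap_wittCoeff α f).trans h)
  rw [← this]
  rfl

omit [PerfectRing B p] in
-- Residues are the coordinates modulo `p` with respect to the divided monomials, and serve to prove
-- that elements are not divisible by `p`.
theorem residue_of_dvd (α : Fin n → PExp p) {f : pdPoly p n B} (h : (p : pdPoly p n B) ∣ f) :
    residue p n B α f = 0 := by
  obtain ⟨g, rfl⟩ := h
  have e : residue p n B α (p * g) = p * residue p n B α g := by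
    rw [← nsmul_eq_mul, map_nsmul, nsmul_eq_mul]
  rw [e, CharP.cast_eq_zero, zero_mul]

open scoped Classical in
-- The factor arises because `x^α` is `⌊α⌋!` times the divided monomial.
theorem residue_const_mul_monomial (w : WittVector p B) (α β : Fin n → PExp p) :
    residue p n B β (const p n B w * monomial p n B (.ofAdd α)) =
      factFloor p β * (AddMonoidAlgebra.single α (constantCoeff w) : PerfPoly p B n).coeff β := by
  rw [residue_eq (w := (factFloor p β : WittVector p B) * if α = β then w else 0), map_mul,
    map_natCast,
    AddMonoidAlgebra.coeff_single, Finsupp.single_apply]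
  · split_ifs <;> simp
  · rw [coe_const_mul_monomial, AddMonoidAlgebra.coeff_single, Finsupp.single_apply, map_mul,
      map_natCast]
    split_ifs <;> simp

open scoped Classical in
theorem residue_const_mul (w : WittVector p B) (α β : Fin n → PExp p) (e : pdPoly p n B)
    (he : (factFloor p α : pdPoly p n B) * e = monomial p n B (.ofAdd α)) :
    residue p n B β (const p n B w * e) =
      (AddMonoidAlgebra.single α (constantCoeff w) : PerfPoly p B n).coeff β := by
  obtain ⟨e', he', h⟩ := exists_factFloor_mul (B := B) α
  have : e = e' := sub_eq_zero.1 (eq_zero_of_natCast_mul_eq_zero (factFloor_ne_zero p α)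
    (by rw [mul_sub, he, he', sub_self]))
  rw [this, residue_eq (w := if α = β then w else 0), AddMonoidAlgebra.coeff_single,
    Finsupp.single_apply]
  · split_ifs <;> simp
  · rw [h, AddMonoidAlgebra.coeff_single, Finsupp.single_apply]
    split_ifs with hαβ
    · subst hαβ
      rw [mul_left_comm, Ring.mul_inverse_cancel _
        (isUnit_natCast_fractionRing p B (factFloor_ne_zero p α)), mul_one]
    · simp

end Perfect

end PDPoly

end PDPoly

end Acris

end

noncomputable section

namespace Acris

open WittVector Finset

/-! ### The completed divided power polynomial ring and its reduction modulo `p`. -/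

section Model

variable (p : ℕ) [hp : Fact p.Prime] (n : ℕ) (B : Type*) [CommRing B] [CharP B p] [PerfectRing B p]

/-- The `p`-adic completion of the ring of divided power polynomials. -/
abbrev PDComplete : Type _ := PCompletion p (pdPoly p n B)

namespace PDComplete

/-- The canonical map to the completion. -/
abbrev ofPoly : pdPoly p n B →+* PDComplete p n B :=
  algebraMap (pdPoly p n B) (PDComplete p n B)

theorem eq_zero_of_p_mul (y : PDComplete p n B) (h : (p : PDComplete p n B) * y = 0) : y = 0 := by
  refine PCompletion.eq_zero_of_p_mul_eq_zero (RingHom.id (pdPoly p n B)) ?_ ?_ y h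
  · intro f hf
    exact PDPoly.eq_zero_of_natCast_mul_eq_zero hp.1.ne_zero hf
  · intro d hd
    exact hd

/-- Needed for the tilt of `PDComplete` and Fontaine's map. If `p` were a unit, it would divide `1`,
whose residue at `α = 0` is `1`. -/
instance not_isUnit : Fact (¬ IsUnit (p : PDComplete p n B)) := ⟨fun h => by
  have : Nontrivial B := CharP.nontrivial_of_char_ne_one (v := p) hp.1.ne_one
  have h1 : (p : PDComplete p n B) ∣ ofPoly p n B (PDPoly.const p n B 1 *
      PDPoly.monomial p n B (.ofAdd 0)) := h.dvd
  rw [PCompletion.dvd_algebraMap_iff] at h1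
  have h2 := PDPoly.residue_of_dvd 0 h1
  rw [PDPoly.residue_const_mul_monomial, factFloor_zero, AddMonoidAlgebra.coeff_single,
    Finsupp.single_eq_same, map_one, Nat.cast_one, one_mul] at h2
  exact one_ne_zero h2⟩

/-- Reduction modulo `p`. -/
abbrev mod : PDComplete p n B →+* ModP (PDComplete p n B) p := Ideal.Quotient.mk _

variable {p n B} in
omit [CharP B p] [PerfectRing B p] in
theorem mod_eq_zero_iff {y : PDComplete p n B} : mod p n B y = 0 ↔ (p : PDComplete p n B) ∣ y :=
  Ideal.Quotient.eq_zero_iff_dvd _ _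

/-- The homomorphism `B = W(B) / p → PDComplete / p`. -/
def ofCoeff : B →+* ModP (PDComplete p n B) p :=
  RingHom.liftOfSurjective (constantCoeff : WittVector p B →+* B) (constantCoeff_surjective p)
    ⟨(mod p n B).comp ((ofPoly p n B).comp (PDPoly.const p n B)), by
      rw [ker_constantCoeff, Ideal.span_le, Set.singleton_subset_iff, SetLike.mem_coe,
        RingHom.mem_ker, map_natCast]
      rw [← map_natCast (mod p n B), mod_eq_zero_iff]⟩

theorem ofCoeff_constantCoeff (w : WittVector p B) :
    ofCoeff p n B (constantCoeff w) = mod p n B (ofPoly p n B (PDPoly.const p n B w)) :=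
  RingHom.liftOfSurjective_comp_apply ..

/-- The homomorphism `b x^α ↦ b x^α`. -/
def ofPerfPoly : PerfPoly p B n →+* ModP (PDComplete p n B) p :=
  AddMonoidAlgebra.liftNCRingHom (ofCoeff p n B)
    (((mod p n B).comp (ofPoly p n B)).toMonoidHom.comp (PDPoly.monomial p n B))
    fun _ _ => Commute.all _ _

variable {p n B}

theorem ofPerfPoly_single (α : Fin n → PExp p) (w : WittVector p B) :
    ofPerfPoly p n B (AddMonoidAlgebra.single α (constantCoeff w)) =
      mod p n B (ofPoly p n B (PDPoly.const p n B w * PDPoly.monomial p n B (.ofAdd α))) := by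
  rw [ofPerfPoly, AddMonoidAlgebra.liftNCRingHom_single, ofCoeff_constantCoeff, map_mul, map_mul]
  rfl

theorem ofPerfPoly_single_one (α : Fin n → PExp p) :
    ofPerfPoly p n B (AddMonoidAlgebra.single α 1) =
      mod p n B (ofPoly p n B (PDPoly.monomial p n B (.ofAdd α))) := by
  rw [← map_one (constantCoeff : WittVector p B →+* B), ofPerfPoly_single, map_one, one_mul]

theorem exists_ofPerfPoly_eq (q : PerfPoly p B n) :
    ∃ m, ofPerfPoly p n B q = mod p n B (ofPoly p n B m) ∧
      ∀ α, PDPoly.residue p n B α m = factFloor p α * q.coeff α := by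
  induction q using AddMonoidAlgebra.induction_linear with
  | zero => exact ⟨0, by simp⟩
  | add f g hf hg =>
    obtain ⟨m, h1, h2⟩ := hf
    obtain ⟨m', h1', h2'⟩ := hg
    refine ⟨m + m', by rw [map_add, h1, h1', map_add, map_add], fun α => ?_⟩
    rw [map_add, h2, h2', AddMonoidAlgebra.coeff_add, Finsupp.add_apply, mul_add]
  | single α b =>
    obtain ⟨w, rfl⟩ := constantCoeff_surjective p b
    exact ⟨_, ofPerfPoly_single α w, PDPoly.residue_const_mul_monomial w α⟩

theorem factFloor_mul_coeff_eq_zero {q : PerfPoly p B n} (hq : ofPerfPoly p n B q = 0)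
    (α : Fin n → PExp p) : (factFloor p α : B) * q.coeff α = 0 := by
  obtain ⟨m, h1, h2⟩ := exists_ofPerfPoly_eq q
  rw [h1, mod_eq_zero_iff, PCompletion.dvd_algebraMap_iff] at hq
  rw [← h2, PDPoly.residue_of_dvd α hq]

/-- The coefficient of `q^p` at `p • α` is the `p`-th power of that of `q` at `α`, and it is killed
by `⌊pα⌋!`. If all `α i < 1`, this integer is a unit in `B`. -/
theorem mem_span_X_of_ofPerfPoly_pow {q : PerfPoly p B n} (hq : ofPerfPoly p n B (q ^ p) = 0) :
    q ∈ Ideal.span (Set.range (PerfPoly.X p B (n := n))) := by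
  rw [PerfPoly.mem_span_X_iff]
  intro α hα
  by_contra! h
  refine hα (PerfPoly.pow_eq_zero (p := p) ?_)
  have h1 := factFloor_mul_coeff_eq_zero hq (p • α)
  rw [PerfPoly.coeff_pow] at h1
  have h2 : IsUnit (factFloor p (p • α) : B) := by
    rw [CharP.isUnit_natCast_iff hp.1, factFloor, hp.1.prime.dvd_finsetProd_iff]
    rintro ⟨i, -, hi⟩
    rw [hp.1.dvd_factorial] at hi
    exact absurd (PExp.floor_nsmul_lt (h i)) (not_lt.2 hi)
  exact h2.mul_right_eq_zero.1 h1

/-- The divided powers of the variables. -/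
theorem exists_factorial_mul (i : Fin n) (m : ℕ) : ∃ e : pdPoly p n B,
    (m.factorial : pdPoly p n B) * e =
      PDPoly.monomial p n B (.ofAdd (Pi.single i (PExp.one p))) ^ m := by
  obtain ⟨e, he, -⟩ := PDPoly.exists_factFloor_mul (B := B)
    (m • Pi.single i (PExp.one p) : Fin n → PExp p)
  have h1 : factFloor p (m • Pi.single i (PExp.one p) : Fin n → PExp p) = m.factorial := by
    rw [factFloor, Finset.prod_eq_single i]
    · rw [Pi.smul_apply, Pi.single_eq_same, ← zero_add (m • _), PExp.floor_add_nsmul,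
        PExp.floor_zero, zero_add]
    · intro j _ hj
      rw [Pi.smul_apply, Pi.single_eq_of_ne hj, smul_zero, PExp.floor_zero, Nat.factorial_zero]
    · simp
  refine ⟨e, ?_⟩
  rw [← h1, he, ofAdd_nsmul, map_pow]

/-- `x_i^p` is `p!` times a divided power, hence divisible by `p`. -/
theorem ofPerfPoly_X_pow (i : Fin n) : ofPerfPoly p n B (PerfPoly.X p B i ^ p) = 0 := by
  obtain ⟨e, he⟩ := exists_factorial_mul (B := B) i p
  rw [map_pow, PerfPoly.X, ofPerfPoly_single_one, ← map_pow, ← map_pow, ← he, mod_eq_zero_iff,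
    PCompletion.dvd_algebraMap_iff, ← Nat.mul_factorial_pred hp.1.ne_zero, Nat.cast_mul, mul_assoc]
  exact Dvd.intro _ rfl

end PDComplete

end Model

end Acris

end

noncomputable section

namespace Acris

open WittVector Finset

/-! ### Divided powers in torsion-free rings. -/

section DividedPowerIdeal

variable {p : ℕ} [hp : Fact p.Prime]

/-- The ideal of elements all of whose powers `y ^ n` are divisible by `n!`. -/
def factorialIdeal (O : Type*) [CommRing O] : Ideal O where
  carrier := {y | ∀ n : ℕ, ∃ z, (n.factorial : O) * z = y ^ n}
  zero_mem' n := by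
    rcases eq_or_ne n 0 with rfl | hn
    · exact ⟨1, by simp⟩
    · exact ⟨0, by simp [hn]⟩
  add_mem' {x y} hx hy n := by
    choose z hz using hx
    choose w hw using hy
    refine ⟨∑ k ∈ antidiagonal n, z k.1 * w k.2, ?_⟩
    rw [Commute.add_pow' (Commute.all x y), mul_sum]
    refine sum_congr rfl fun k hk => ?_
    rw [← hz, ← hw, nsmul_eq_mul, ← mem_antidiagonal.1 hk,
      ← Nat.add_choose_mul_factorial_mul_factorial, Nat.choose_symm_add]
    push_cast
    ring
  smul_mem' a y hy n := by
    obtain ⟨z, hz⟩ := hy n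
    exact ⟨a ^ n * z, by rw [smul_eq_mul, mul_pow, ← hz]; ring⟩

theorem p_mem_factorialIdeal {O : Type*} [CommRing O] (z : ℤ_[p] →+* O) :
    (p : O) ∈ factorialIdeal O := by
  intro n
  rcases eq_or_ne n 0 with rfl | hn
  · exact ⟨1, by simp⟩
  · refine ⟨z (p * pdCoeff p n), ?_⟩
    rw [← map_natCast z, ← map_mul, factorial_mul_p_mul_pdCoeff p hn, map_pow, map_natCast]

/-- A homomorphism to a torsion-free ring extends to the PD hull as soon as the required divided
powers exist. -/
theorem PDHull.exists_lift {R O : Type*} [CommRing R] [CommRing O] {z : ℤ_[p] →+* R} {J : Ideal R}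
    (g : R →+* O) (hO : ∀ y : O, (p : O) * y = 0 → y = 0)
    (hg : ∀ x ∈ J, g x ∈ factorialIdeal O) :
    ∃ G : PDHull z J →+* O, (∀ r, G (of z J r) = g r) ∧
      ∀ n x, (n.factorial : O) * G (dp z J n x) = g x ^ n := by
  choose f hf using fun (n : ℕ) (x : J) => hg x x.2 n
  -- Integers cancel in `O`, so `n! f_n(x) = g(x)^n` determines `f_n`, and every divided power
  -- identity follows after multiplication by factorials.
  have cancel : ∀ {m : ℕ} (_ : m ≠ 0) {x y : O}, (m : O) * x = m * y → x = y :=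
    fun hm _ _ h => natCast_mul_cancel (g.comp z) hO hm h
  have hfac : ∀ m : ℕ, m.factorial ≠ 0 := Nat.factorial_ne_zero
  have f_smul : ∀ (n : ℕ) (r : R) (x : J), f n (r • x) = g r ^ n * f n x := fun n r x =>
    cancel (hfac n) (by
      rw [hf, mul_left_comm, hf, ← mul_pow, ← map_mul]; rfl)
  have f_mul : ∀ (m n : ℕ) (x : J), f m x * f n x = (m + n).choose m • f (m + n) x := fun m n x =>
    cancel (mul_ne_zero (hfac m) (hfac n)) (by
      have h1 := hf (m + n) x
      rw [add_comm m n, ← Nat.add_choose_mul_factorial_mul_factorial, add_comm n m,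
        pow_add, ← hf, ← hf] at h1
      rw [nsmul_eq_mul]
      push_cast at h1 ⊢
      linear_combination -h1)
  have f_add : ∀ (n : ℕ) (x y : J), f n (x + y) = ∑ k ∈ antidiagonal n, f k.1 x * f k.2 y :=
    fun n x y => cancel (hfac n) (by
      have e : g ((x + y : J) : R) = g x + g y := map_add g _ _
      rw [hf, e, Commute.add_pow' (Commute.all _ _), mul_sum]
      refine sum_congr rfl fun k hk => ?_
      rw [← hf, ← hf, nsmul_eq_mul, ← mem_antidiagonal.1 hk,
        ← Nat.add_choose_mul_factorial_mul_factorial, Nat.choose_symm_add]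
      push_cast
      ring)
  refine ⟨PDHull.lift g f (fun x => ?_) (fun x => ?_) f_smul f_mul f_add
    (fun n a ha x hx => ?_), fun r => lift_of .., fun n x => ?_⟩
  · simpa using hf 0 x
  · simpa using hf 1 x
  · refine cancel (hfac n) ?_
    rw [hf, hx, ← map_pow, ← map_pow, ← (PadicInt.dividedPowers p).factorial_mul_dpow_eq_pow ha,
      map_mul, map_mul, map_natCast, map_natCast]
  · rw [lift_dp, hf]

end DividedPowerIdeal

/-! ### From a presentation of `C` to the map `W(C^♭) → PDComplete`. -/

section Presentation

variable {p : ℕ} [hp : Fact p.Prime] {n : ℕ} {B : Type*} [CommRing B] [CharP B p]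
  [PerfectRing B p] {C : Type*} [CommRing C] [Algebra (ZMod p) C]
  (π : PerfPoly p B n →+* C)

/-- The lift of `B[x^{p^{-∞}}] → C` to the tilt. -/
def toTiltOfPerfPoly : PerfPoly p B n →+* Tilt p C where
  toFun q := ⟨fun m => π ((frobeniusEquiv (PerfPoly p B n) p).symm^[m] q), fun m => by
    rw [← map_pow, Function.iterate_succ_apply', frobeniusEquiv_symm_pow_p]⟩
  map_one' := Subtype.ext <| funext fun m => by simp [iterate_map_one]
  map_mul' a b := Subtype.ext <| funext fun m => by simp [iterate_map_mul]
  map_zero' := Subtype.ext <| funext fun m => by simp [iterate_map_zero]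
  map_add' a b := Subtype.ext <| funext fun m => by simp [iterate_map_add]

theorem nu_zero_toTilt (q : PerfPoly p B n) : nu p 0 (toTiltOfPerfPoly π q) = π q := rfl

theorem nu_one_toTilt_pow (q : PerfPoly p B n) :
    nu p 1 (toTiltOfPerfPoly π (q ^ p)) = π q := by
  rw [map_pow, map_pow, nu_succ_pow, nu_zero_toTilt]

theorem nu_one_toTilt_X (i : Fin n) :
    nu p 1 (toTiltOfPerfPoly π (PerfPoly.X p B i)) = π (PerfPoly.rootX p B n i) := by
  rw [← PerfPoly.rootX_pow, nu_one_toTilt_pow]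

variable {π} (hπ : Function.Surjective π)
  (hker : RingHom.ker π = Ideal.span (Set.range (PerfPoly.X p B (n := n))))

include hπ in
theorem nu_surjective (m : ℕ) : Function.Surjective (nu p (C := C) m) := by
  intro c
  obtain ⟨q, rfl⟩ := hπ c
  refine ⟨toTiltOfPerfPoly π (q ^ p ^ m), ?_⟩
  induction m with
  | zero => rw [pow_zero, pow_one, nu_zero_toTilt]
  | succ m ih => rw [pow_succ, pow_mul, map_pow, map_pow, nu_succ_pow, ih]

include hker in
theorem nu_toTilt_X (i : Fin n) : nu p 0 (toTiltOfPerfPoly π (PerfPoly.X p B i)) = 0 := by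
  rw [nu_zero_toTilt, ← RingHom.mem_ker, hker]
  exact Ideal.subset_span ⟨i, rfl⟩

include hπ hker in
omit [Algebra (ZMod p) C] in
theorem mem_map_rootX_of_pow_eq_zero {c : C} (hc : c ^ p = 0) :
    c ∈ (Ideal.span (Set.range (PerfPoly.rootX p B n))).map π := by
  obtain ⟨q, rfl⟩ := hπ c
  refine Ideal.mem_map_of_mem π (PerfPoly.mem_span_rootX_of_pow_mem ?_)
  rw [← hker, RingHom.mem_ker, map_pow, hc]

include hπ hker in
-- `ν_1(y)^p = ν_0(y) = 0`, so `ν_1(y)` lies in the ideal of the `x_i^{1/p}` and equals `ν_1(t)` for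
-- some `t` in the ideal of the lifted `x_i`. The `p`-th root of `y - t` is then killed by `ν_0`.
theorem exists_sub_eq_pow {y : Tilt p C} (hy : nu p 0 y = 0) :
    ∃ t ∈ (Ideal.span (Set.range (PerfPoly.X p B (n := n)))).map (toTiltOfPerfPoly π),
      ∃ u, nu p 0 u = 0 ∧ y = t + u ^ p := by
  have h1 := mem_map_rootX_of_pow_eq_zero hπ hker ((nu_succ_pow p 0 y).trans hy)
  have h2 : (Ideal.span (Set.range (PerfPoly.rootX p B n))).map π =
      ((Ideal.span (Set.range (PerfPoly.X p B (n := n)))).map (toTiltOfPerfPoly π)).map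
        (nu p (C := C) 1 : Tilt p C →+* C) := by
    rw [Ideal.map_map, Ideal.map_span, Ideal.map_span, ← Set.range_comp, ← Set.range_comp]
    congr 2
    ext1 i
    exact (nu_one_toTilt_X π i).symm
  rw [h2] at h1
  obtain ⟨t, ht, ht'⟩ := (Ideal.mem_map_iff_of_surjective
    (nu p (C := C) 1 : Tilt p C →+* C) (nu_surjective hπ 1)).1 h1
  refine ⟨t, ht, Tilt.root p C (y - t), ?_, ?_⟩
  · rw [nu_root, map_sub, sub_eq_zero]
    exact ht'.symm
  · rw [Tilt.root_pow]; ring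

/-- The homomorphism `C → PDComplete / p` whose composite with `π` is the Frobenius. -/
def phi : C →+* ModP (PDComplete p n B) p :=
  RingHom.liftOfSurjective π hπ
    ⟨(PDComplete.ofPerfPoly p n B).comp (_root_.frobenius (PerfPoly p B n) p), by
      rw [hker, Ideal.span_le]
      rintro _ ⟨i, rfl⟩
      exact PDComplete.ofPerfPoly_X_pow i⟩

omit [Algebra (ZMod p) C] in
theorem phi_apply (q : PerfPoly p B n) :
    phi hπ hker (π q) = PDComplete.ofPerfPoly p n B (q ^ p) :=
  RingHom.liftOfSurjective_comp_apply ..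

omit [Algebra (ZMod p) C] in
theorem eq_zero_of_phi_eq_zero {c : C} (hc : phi hπ hker c = 0) : c = 0 := by
  obtain ⟨q, rfl⟩ := hπ c
  rw [phi_apply] at hc
  rw [← RingHom.mem_ker, hker]
  exact PDComplete.mem_span_X_of_ofPerfPoly_pow hc

variable [CharP C p]

/-- The map from the tilt of `C` to the tilt of the divided power ring. -/
def tiltToPreTilt : Tilt p C →+* PreTilt (PDComplete p n B) p :=
  (Perfection.lift p (Tilt p C) (ModP (PDComplete p n B) p)
    ((phi hπ hker).comp (nu p (C := C) 1 : Tilt p C →+* C)) :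
    Tilt p C →+* Perfection (ModP (PDComplete p n B) p) p)

theorem coeff_zero_tiltToPreTilt (c : Tilt p C) :
    PreTilt.coeff 0 (tiltToPreTilt hπ hker c) = phi hπ hker (nu p 1 c) := rfl

/-- The map `W(C^♭) → PDComplete`. -/
def wittToPDComplete : WittVector p (Tilt p C) →+* PDComplete p n B :=
  (fontaineTheta (PDComplete p n B) p).comp (WittVector.map (tiltToPreTilt hπ hker))

theorem mod_wittToPDComplete (r : WittVector p (Tilt p C)) :
    PDComplete.mod p n B (wittToPDComplete hπ hker r) = phi hπ hker (nu p 1 (r.coeff 0)) :=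
  (mk_fontaineTheta _).trans (by rw [map_coeff, coeff_zero_tiltToPreTilt])

/-- The `p`-th root in `nu p 1` cancels the `p`-th power in `phi`, so the monomials are not raised
to a power. -/
theorem mod_wittToPDComplete_teichmuller (q : PerfPoly p B n) :
    PDComplete.mod p n B (wittToPDComplete hπ hker (teichmuller p (toTiltOfPerfPoly π q))) =
      PDComplete.ofPerfPoly p n B q := by
  obtain ⟨q', hq'⟩ := (PerfectRing.bijective_frobenius (R := PerfPoly p B n) (p := p)).surjective q
  have hq : q' ^ p = q := hq'
  rw [mod_wittToPDComplete, teichmuller_coeff_zero, ← hq, nu_one_toTilt_pow, phi_apply]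

/-- Both sides are multiplicative in `α` and agree modulo `p` for every `α`. Since `α` is divisible
by `p^j`, raising to the power `p^j` improves this to agreement modulo `p^{j+1}`. -/
theorem wittToPDComplete_teichmuller_single (α : Fin n → PExp p) :
    wittToPDComplete hπ hker (teichmuller p (toTiltOfPerfPoly π (AddMonoidAlgebra.single α 1))) =
      PDComplete.ofPoly p n B (PDPoly.monomial p n B (.ofAdd α)) := by
  have h1 : ∀ α : Fin n → PExp p, (p : PDComplete p n B) ∣
      wittToPDComplete hπ hker (teichmuller p (toTiltOfPerfPoly π (AddMonoidAlgebra.single α 1))) -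
        PDComplete.ofPoly p n B (PDPoly.monomial p n B (.ofAdd α)) := fun α => by
    rw [← PDComplete.mod_eq_zero_iff, map_sub, mod_wittToPDComplete_teichmuller,
      PDComplete.ofPerfPoly_single_one, sub_self]
  refine sub_eq_zero.1 (eq_zero_of_forall_pow_dvd (p : PDComplete p n B) fun j => ?_)
  have h2 : ∀ j, ∃ β : Fin n → PExp p, p ^ j • β = α := by
    intro j
    induction j with
    | zero => exact ⟨α, by simp⟩
    | succ j ih =>
      obtain ⟨β, rfl⟩ := ih
      refine ⟨fun i => PExp.root p (β i), ?_⟩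
      rw [pow_succ, mul_smul]
      congr 1
      exact funext fun i => PExp.nsmul_root p (β i)
  obtain ⟨β, rfl⟩ := h2 j
  have h3 := dvd_sub_pow_of_dvd_sub (h1 β) j
  rw [← map_pow, ← map_pow, ← map_pow, AddMonoidAlgebra.single_pow, one_pow, ← map_pow,
    ← map_pow, ← ofAdd_nsmul] at h3
  exact (pow_dvd_pow _ (Nat.le_succ j)).trans h3

/-- Modulo `p` the image is `phi` of an element of the ideal of the `x_i^{1/p}`, and `phi` sends
`x_i^{1/p}` to `x_i`, which has divided powers. The error is a multiple of `p`, which has them as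
well. -/
theorem wittToPDComplete_mem_factorialIdeal {r : WittVector p (Tilt p C)}
    (hr : theta p C r = 0) : wittToPDComplete hπ hker r ∈ factorialIdeal (PDComplete p n B) := by
  have hp' : (p : PDComplete p n B) ∈ factorialIdeal (PDComplete p n B) :=
    p_mem_factorialIdeal ((wittToPDComplete hπ hker).comp (zpToWitt p _))
  have hx : ∀ i, PDComplete.ofPoly p n B
      (PDPoly.monomial p n B (.ofAdd (Pi.single i (PExp.one p)))) ∈
        factorialIdeal (PDComplete p n B) := fun i m => by
    obtain ⟨e, he⟩ := PDComplete.exists_factorial_mul (B := B) i m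
    exact ⟨PDComplete.ofPoly p n B e, by rw [← map_natCast (PDComplete.ofPoly p n B), ← map_mul, he,
      map_pow]⟩
  have h1 := mem_map_rootX_of_pow_eq_zero hπ hker ((nu_succ_pow p 0 (r.coeff 0)).trans hr)
  have h2 : PDComplete.mod p n B (wittToPDComplete hπ hker r) ∈
      (factorialIdeal (PDComplete p n B)).map (PDComplete.mod p n B) := by
    rw [mod_wittToPDComplete]
    have h3 : (Ideal.span (Set.range (PerfPoly.rootX p B n))).map π ≤
        ((factorialIdeal (PDComplete p n B)).map (PDComplete.mod p n B)).comap
          (phi hπ hker) := by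
      rw [Ideal.map_span, Ideal.span_le]
      rintro _ ⟨_, ⟨i, rfl⟩, rfl⟩
      rw [SetLike.mem_coe, Ideal.mem_comap, phi_apply, PerfPoly.rootX_pow, PerfPoly.X,
        PDComplete.ofPerfPoly_single_one]
      exact Ideal.mem_map_of_mem _ (hx i)
    exact h3 h1
  rw [Ideal.mem_map_iff_of_surjective _ Ideal.Quotient.mk_surjective] at h2
  obtain ⟨y, hy, hy'⟩ := h2
  rw [← sub_eq_zero, ← map_sub, PDComplete.mod_eq_zero_iff] at hy'
  have := sub_mem hy (Ideal.mem_of_dvd _ hy' hp')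
  rwa [sub_sub_cancel] at this

end Presentation

end Acris

end

noncomputable section

namespace Acris

open WittVector Finset

theorem PDHull.map_dp_zero_mem {p : ℕ} [hp : Fact p.Prime] {R : Type*} [CommRing R]
    {z : ℤ_[p] →+* R} {J : Ideal R} {Q : Type*} [CommRing Q] (f : PDHull z J →+* Q)
    (S : Subring Q) (m : ℕ) : f (dp z J m 0) ∈ S := by
  rcases eq_or_ne m 0 with rfl | hm
  · rw [dp_zero, map_one]; exact one_mem _
  · have h := dp_smul (z := z) m (0 : R) (0 : J)
    rw [zero_smul, map_zero, zero_pow hm, zero_mul] at h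
    rw [h, map_zero]; exact zero_mem _

/-- The elements of `J` whose divided powers are mapped to a given subring. -/
def PDHull.dpIdeal {p : ℕ} [hp : Fact p.Prime] {R : Type*} [CommRing R] {z : ℤ_[p] →+* R}
    {J : Ideal R} {Q : Type*} [CommRing Q] (f : PDHull z J →+* Q) (S : Subring Q)
    (hS : ∀ r, f (of z J r) ∈ S) : Ideal R where
  carrier := {x | ∃ h : x ∈ J, ∀ m, f (dp z J m ⟨x, h⟩) ∈ S}
  zero_mem' := ⟨zero_mem _, fun m => by
    have e : (⟨0, zero_mem J⟩ : J) = 0 := rfl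
    rw [e]
    exact map_dp_zero_mem f S m⟩
  add_mem' := fun ⟨hx, hx'⟩ ⟨hy, hy'⟩ => ⟨add_mem hx hy, fun m => by
    rw [show (⟨_, add_mem hx hy⟩ : J) = ⟨_, hx⟩ + ⟨_, hy⟩ from rfl, dp_add, map_sum]
    exact sum_mem fun k _ => by rw [map_mul]; exact mul_mem (hx' _) (hy' _)⟩
  smul_mem' := fun r x ⟨hx, hx'⟩ => ⟨Ideal.mul_mem_left _ r hx, fun m => by
    rw [show (⟨r • x, Ideal.mul_mem_left _ r hx⟩ : J) = r • ⟨x, hx⟩ from rfl, dp_smul, map_mul,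
      map_pow]
    exact mul_mem (pow_mem (hS r) m) (hx' m)⟩

namespace AcrisHull

/-! ### The PD hull modulo `p`. -/

section ModP

variable (p : ℕ) [hp : Fact p.Prime] (C : Type*) [CommRing C] [Algebra (ZMod p) C]

/-- The reduction of the PD hull modulo `p`. -/
abbrev Red : Type _ := AcrisHull p C ⧸ Ideal.span {(p : AcrisHull p C)}

/-- Reduction modulo `p`. -/
abbrev red : AcrisHull p C →+* Red p C := Ideal.Quotient.mk _

variable {p C} in
theorem red_eq_zero_iff {d : AcrisHull p C} : red p C d = 0 ↔ (p : AcrisHull p C) ∣ d :=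
  Ideal.Quotient.eq_zero_iff_dvd _ _

theorem red_p : (p : Red p C) = 0 := by
  rw [← map_natCast (red p C), red_eq_zero_iff]

variable [CharP C p]

/-- The homomorphism `C^♭ = W(C^♭) / p → PDHull / p`. -/
def ofTilt : Tilt p C →+* Red p C :=
  RingHom.liftOfSurjective (constantCoeff : WittVector p (Tilt p C) →+* Tilt p C)
    (constantCoeff_surjective p)
    ⟨(red p C).comp (PDHull.of _ _), by
      rw [ker_constantCoeff, Ideal.span_le, Set.singleton_subset_iff, SetLike.mem_coe,
        RingHom.mem_ker, map_natCast, red_p]⟩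

theorem ofTilt_constantCoeff (r : WittVector p (Tilt p C)) :
    ofTilt p C (constantCoeff r) = red p C (PDHull.of _ _ r) :=
  RingHom.liftOfSurjective_comp_apply ..

variable {p C}

theorem ofTilt_eq (c : Tilt p C) : ofTilt p C c = red p C (PDHull.of _ _ (teichmuller p c)) := by
  rw [← ofTilt_constantCoeff, constantCoeff_apply, teichmuller_coeff_zero]

theorem ofTilt_pow {c : Tilt p C} (hc : nu p 0 c = 0) (m : ℕ) :
    ofTilt p C c ^ m = m.factorial *
      red p C (PDHull.dp _ _ m ⟨teichmuller p c, teichmuller_mem_ker hc⟩) := by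
  rw [ofTilt_eq, ← map_natCast (red p C), ← map_mul, PDHull.factorial_mul_dp, map_pow]

theorem ofTilt_pow_p {c : Tilt p C} (hc : nu p 0 c = 0) : ofTilt p C c ^ p = 0 := by
  rw [ofTilt_pow hc, ← Nat.mul_factorial_pred hp.1.ne_zero, Nat.cast_mul, red_p, zero_mul, zero_mul]

end ModP

/-! ### Divided monomials span the PD hull modulo `p`. -/

section Presentation

variable {p : ℕ} [hp : Fact p.Prime] {n : ℕ} {B : Type*} [CommRing B] [CharP B p]
  [PerfectRing B p] {C : Type*} [CommRing C] [Algebra (ZMod p) C] [CharP C p]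
  {π : PerfPoly p B n →+* C} (hπ : Function.Surjective π)
  (hker : RingHom.ker π = Ideal.span (Set.range (PerfPoly.X p B (n := n))))

/-- The Teichmüller lift of `x_i` as an element of the kernel of `W(C^♭) → C`. -/
def kerX (i : Fin n) : RingHom.ker (theta p C) :=
  ⟨teichmuller p (toTiltOfPerfPoly π (PerfPoly.X p B i)), teichmuller_mem_ker (nu_toTilt_X hker i)⟩

/-- The classes of the products `∏ γ_{m_i}([x_i])`. -/
def dpX (m : Fin n → ℕ) : Red p C := ∏ i, red p C (PDHull.dp _ _ (m i) (kerX hker i))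

omit [CharP C p] in
theorem dpX_mul (l m : Fin n → ℕ) :
    dpX hker l * dpX hker m =
      ((∏ i, (l i + m i).choose (l i) : ℕ) : Red p C) * dpX hker (l + m) := by
  rw [dpX, dpX, dpX, ← prod_mul_distrib, Nat.cast_prod, ← prod_mul_distrib]
  refine prod_congr rfl fun i _ => ?_
  rw [← map_mul, PDHull.dp_mul, map_nsmul, nsmul_eq_mul]
  rfl

omit [CharP C p] in
theorem dpX_zero : dpX hker 0 = 1 :=
  prod_eq_one fun i _ => by rw [Pi.zero_apply, PDHull.dp_zero, map_one]

omit [CharP C p] in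
theorem dpX_single (i : Fin n) (m : ℕ) :
    dpX hker (Pi.single i m) = red p C (PDHull.dp _ _ m (kerX hker i)) := by
  rw [dpX, Fintype.prod_eq_single i, Pi.single_eq_same]
  intro j hj
  rw [Pi.single_eq_of_ne hj, PDHull.dp_zero, map_one]

/-- The homomorphism `B[x^{p^{-∞}}] → PDHull / p` induced by `π`. -/
def ofPerf (π : PerfPoly p B n →+* C) : PerfPoly p B n →+* Red p C :=
  (ofTilt p C).comp (toTiltOfPerfPoly π)

theorem ofPerf_nsmul_one (l : Fin n → ℕ) :
    ofPerf π (AddMonoidAlgebra.single (fun i => l i • PExp.one p) 1) =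
      ((∏ i, (l i).factorial : ℕ) : Red p C) * dpX hker l := by
  have e : (AddMonoidAlgebra.single (fun i => l i • PExp.one p) 1 : PerfPoly p B n) =
      ∏ i, PerfPoly.X p B i ^ l i := by
    have h1 := map_prod (AddMonoidAlgebra.of B (Fin n → PExp p))
      (fun i => .ofAdd (Pi.single i (l i • PExp.one p))) univ
    rw [← ofAdd_sum, univ_sum_single] at h1
    refine h1.trans (prod_congr rfl fun i _ => ?_)
    rw [PerfPoly.X, AddMonoidAlgebra.single_pow, one_pow, ← Pi.single_smul]
    rfl
  rw [e, map_prod, dpX, Nat.cast_prod, ← prod_mul_distrib]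
  refine prod_congr rfl fun i _ => ?_
  rw [map_pow]
  exact ofTilt_pow (nu_toTilt_X hker i) (l i)

/-- The additive map `b x^α ↦ b x^{α - ⌊α⌋} ∏ γ_{⌊α_i⌋}(x_i)`. -/
def dividedMonomials : PerfPoly p B n →+ Red p C :=
  AddMonoidAlgebra.liftNC
    ((ofPerf π).comp AddMonoidAlgebra.singleZeroRingHom : B →+* Red p C).toAddMonoidHom
    fun α => ofPerf π (AddMonoidAlgebra.single (fun i => PExp.frac (α.toAdd i)) 1) *
      dpX hker fun i => PExp.floor (α.toAdd i)

theorem dividedMonomials_single (α : Fin n → PExp p) (b : B) :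
    dividedMonomials hker (AddMonoidAlgebra.single α b) =
      ofPerf π (AddMonoidAlgebra.single (fun i => PExp.frac (α i)) b) *
        dpX hker fun i => PExp.floor (α i) := by
  have e : ofPerf π (AddMonoidAlgebra.single (fun i => PExp.frac (α i)) b) =
      ofPerf π (AddMonoidAlgebra.single 0 b) *
        ofPerf π (AddMonoidAlgebra.single (fun i => PExp.frac (α i)) 1) := by
    rw [← map_mul, AddMonoidAlgebra.single_mul_single, zero_add, mul_one]
  rw [e, mul_assoc, dividedMonomials, AddMonoidAlgebra.liftNC_single]
  rfl

/-- Splitting `β` into fractional and integral parts, the integral part becomes `∏ l_i!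
γ_{l_i}(x_i)`, which merges with `dpX` up to binomial coefficients. -/
theorem ofPerf_single_mul_dpX_mem (β : Fin n → PExp p) (b : B) (m : Fin n → ℕ) :
    ofPerf π (AddMonoidAlgebra.single β b) * dpX hker m ∈ (dividedMonomials hker).range := by
  have e : (AddMonoidAlgebra.single β b : PerfPoly p B n) =
      AddMonoidAlgebra.single (fun i => PExp.frac (β i)) b *
        AddMonoidAlgebra.single (fun i => PExp.floor (β i) • PExp.one p) 1 := by
    rw [AddMonoidAlgebra.single_mul_single, mul_one]
    congr 1
    exact funext fun i => (PExp.frac_add_floor (β i)).symm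
  have h := dividedMonomials_single hker (fun i => β i + m i • PExp.one p) b
  simp only [PExp.frac_add_nsmul, PExp.floor_add_nsmul] at h
  rw [e, map_mul, ofPerf_nsmul_one hker, mul_assoc, mul_assoc, dpX_mul,
    mul_left_comm, mul_left_comm (ofPerf π _), ← nsmul_eq_mul, ← nsmul_eq_mul]
  refine nsmul_mem (nsmul_mem ?_ _) _
  exact ⟨_, h⟩

theorem ofPerf_mem (q : PerfPoly p B n) : ofPerf π q ∈ (dividedMonomials hker).range := by
  induction q using AddMonoidAlgebra.induction_linear with
  | zero => rw [map_zero]; exact zero_mem _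
  | add f g hf hg => rw [map_add]; exact add_mem hf hg
  | single β b =>
    have := ofPerf_single_mul_dpX_mem hker β b 0
    rwa [dpX_zero, mul_one] at this

theorem mul_mem_range_dividedMonomials {x y : Red p C} (hx : x ∈ (dividedMonomials hker).range)
    (hy : y ∈ (dividedMonomials hker).range) : x * y ∈ (dividedMonomials hker).range := by
  obtain ⟨q, rfl⟩ := hx
  obtain ⟨r, rfl⟩ := hy
  induction q using AddMonoidAlgebra.induction_linear with
  | zero => rw [map_zero, zero_mul]; exact zero_mem _
  | add f g hf hg => rw [map_add, add_mul]; exact add_mem hf hg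
  | single α a =>
    induction r using AddMonoidAlgebra.induction_linear with
    | zero => rw [map_zero, mul_zero]; exact zero_mem _
    | add f g hf hg => rw [map_add, mul_add]; exact add_mem hf hg
    | single β b =>
      -- The sum of two fractional parts may exceed `1`, so the product is in general only an
      -- integer multiple of a divided monomial.
      rw [dividedMonomials_single, dividedMonomials_single, mul_mul_mul_comm, dpX_mul, ← map_mul,
        AddMonoidAlgebra.single_mul_single, mul_left_comm, ← nsmul_eq_mul]
      exact nsmul_mem (ofPerf_single_mul_dpX_mem hker _ _ _) _

/-- The image of `dividedMonomials`, as a subring. -/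
def dividedMonomialsRange : Subring (Red p C) where
  __ := (dividedMonomials hker).range
  one_mem' := by
    have := ofPerf_mem hker (1 : PerfPoly p B n)
    rwa [map_one] at this
  mul_mem' := mul_mem_range_dividedMonomials hker

include hπ in
-- The class of `c` depends only on `ν_1(c)`: if `ν_1` kills an element, that element is `u^p` with
-- `ν_0(u) = 0`, and `u^p = p! γ_p(u)` vanishes modulo `p`. So `c` may be replaced by the lift of a
-- polynomial.
theorem ofTilt_mem (c : Tilt p C) : ofTilt p C c ∈ dividedMonomialsRange hker := by
  obtain ⟨q, hq⟩ := hπ (nu p 1 c)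
  have h1 : ofTilt p C (Tilt.root p C (c - toTiltOfPerfPoly π (q ^ p))) ^ p = 0 := by
    refine ofTilt_pow_p ?_
    rw [nu_root, map_sub, nu_one_toTilt_pow, hq, sub_self]
  rw [← map_pow, Tilt.root_pow, map_sub, sub_eq_zero] at h1
  rw [h1]
  exact ofPerf_mem hker _

/-- The elements of the kernel all of whose divided powers are in the image of
`dividedMonomials`. -/
def dpIdeal : Ideal (WittVector p (Tilt p C)) :=
  PDHull.dpIdeal (red p C) (dividedMonomialsRange hker) fun r => by
    rw [← ofTilt_constantCoeff]; exact ofTilt_mem hπ hker _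

/-- The divided powers of `p` are prescribed by those of `ℤ_p`, so they come from `W(C^♭)`. -/
theorem p_mem_dpIdeal : (p : WittVector p (Tilt p C)) ∈ dpIdeal hπ hker := by
  have h : (p : WittVector p (Tilt p C)) ∈ RingHom.ker (theta p C) := by
    rw [RingHom.mem_ker, map_natCast, CharP.cast_eq_zero]
  refine ⟨h, fun m => ?_⟩
  rw [PDHull.dp_compat m (Ideal.mem_span_singleton_self (p : ℤ_[p])) ⟨_, h⟩ (map_natCast _ _).symm,
    ← ofTilt_constantCoeff]
  exact ofTilt_mem hπ hker _

theorem teichmuller_X_mem_dpIdeal (i : Fin n) :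
    teichmuller p (toTiltOfPerfPoly π (PerfPoly.X p B i)) ∈ dpIdeal hπ hker := by
  refine ⟨(kerX hker i).2, fun m => ?_⟩
  have h := ofPerf_single_mul_dpX_mem hker 0 1 (Pi.single i m)
  rw [← AddMonoidAlgebra.one_def, map_one, one_mul, dpX_single] at h
  exact h

/-- `γ_m([u^p]) = [u^{p-1}]^m γ_m([u])`, and `u^p` is zero in the hull modulo `p`. -/
theorem teichmuller_pow_mem_dpIdeal {u : Tilt p C} (hu : nu p 0 u = 0) :
    teichmuller p (u ^ p) ∈ dpIdeal hπ hker := by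
  have h : teichmuller p (u ^ p) ∈ RingHom.ker (theta p C) :=
    teichmuller_mem_ker (by rw [map_pow, hu, zero_pow hp.1.ne_zero])
  refine ⟨h, fun m => ?_⟩
  obtain _ | _ | m := m
  · rw [PDHull.dp_zero, map_one]; exact one_mem _
  · rw [zero_add, PDHull.dp_one, ← ofTilt_constantCoeff]; exact ofTilt_mem hπ hker _
  · have e : (⟨teichmuller p (u ^ p), h⟩ : RingHom.ker (theta p C)) =
        teichmuller p (u ^ (p - 1)) • ⟨teichmuller p u, teichmuller_mem_ker hu⟩ := by
      refine Subtype.ext ?_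
      change _ = teichmuller p (u ^ (p - 1)) * teichmuller p u
      rw [← map_mul, pow_sub_one_mul hp.1.ne_zero]
    have hp2 := hp.1.two_le
    -- The exponent `(p - 1) m` reaches `p` as soon as `m ≥ 2`, even for `p = 2`; the values `m = 0,
    -- 1` are treated separately above.
    have hle : p ≤ (p - 1) * (m + 1 + 1) := by
      obtain ⟨a, rfl⟩ := Nat.exists_eq_add_of_le hp2
      rw [show 2 + a - 1 = a + 1 by omega]
      nlinarith
    rw [e, PDHull.dp_smul, map_mul, map_pow, ← ofTilt_eq, map_pow, ← pow_mul,
      pow_eq_zero_of_le hle (ofTilt_pow_p hu), zero_mul]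
    exact zero_mem _

/-- Modulo `p`, `exists_sub_eq_pow` writes an element of the kernel as a combination of the `x_i`
plus some `u^p`; together with `p`, these all have divided powers in the range. -/
theorem ker_theta_le_dpIdeal : RingHom.ker (theta p C) ≤ dpIdeal hπ hker := by
  intro r hr
  obtain ⟨t, ht, u, hu, h⟩ := exists_sub_eq_pow hπ hker (y := r.coeff 0) hr
  have h1 : r.coeff 0 ∈ (dpIdeal hπ hker).map
      (constantCoeff : WittVector p (Tilt p C) →+* Tilt p C) := by
    have key : ∀ c, teichmuller p c ∈ dpIdeal hπ hker → c ∈ (dpIdeal hπ hker).map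
        (constantCoeff : WittVector p (Tilt p C) →+* Tilt p C) := fun c hc => by
      have := Ideal.mem_map_of_mem (constantCoeff : WittVector p (Tilt p C) →+* Tilt p C) hc
      rwa [constantCoeff_apply, teichmuller_coeff_zero] at this
    rw [h]
    refine add_mem ?_ (key _ (teichmuller_pow_mem_dpIdeal hπ hker hu))
    rw [Ideal.map_span] at ht
    refine (Ideal.span_le.2 ?_) ht
    rintro _ ⟨_, ⟨i, rfl⟩, rfl⟩
    exact key _ (teichmuller_X_mem_dpIdeal hπ hker i)
  obtain ⟨y, hy, hy'⟩ := (Ideal.mem_map_iff_of_surjective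
    (constantCoeff : WittVector p (Tilt p C) →+* Tilt p C) (constantCoeff_surjective p)).1 h1
  have h2 : r - y ∈ dpIdeal hπ hker := by
    have h3 : r - y ∈ RingHom.ker (constantCoeff : WittVector p (Tilt p C) →+* Tilt p C) := by
      rw [RingHom.mem_ker, map_sub, hy', constantCoeff_apply, sub_self]
    rw [ker_constantCoeff] at h3
    exact (Ideal.span_singleton_le_iff_mem _).2 (p_mem_dpIdeal hπ hker) h3
  have := add_mem h2 hy
  rwa [sub_add_cancel] at this

include hπ in
theorem dividedMonomials_surjective : Function.Surjective (dividedMonomials hker) := by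
  have key : ∀ d : AcrisHull p C, red p C d ∈ dividedMonomialsRange hker := by
    intro d
    induction d using PDHull.induction with
    | h_of r => rw [← ofTilt_constantCoeff]; exact ofTilt_mem hπ hker _
    | h_add a b ha hb => rw [map_add]; exact add_mem ha hb
    | h_dp a m x ha =>
      rw [map_mul]
      exact mul_mem ha ((ker_theta_le_dpIdeal hπ hker x.2).choose_spec m)
  intro y
  obtain ⟨d, rfl⟩ := Ideal.Quotient.mk_surjective y
  exact key d

end Presentation

end AcrisHull

end Acris

end

noncomputable section

namespace Acris

open WittVector Finset

/-! ### The hull embeds modulo `p` in the divided power ring; consequences for `A_cris`. -/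

section Comparison

variable {p : ℕ} [hp : Fact p.Prime] {n : ℕ} {B : Type*} [CommRing B] [CharP B p]
  [PerfectRing B p] {C : Type*} [CommRing C] [Algebra (ZMod p) C] [CharP C p]
  {π : PerfPoly p B n →+* C} (hπ : Function.Surjective π)
  (hker : RingHom.ker π = Ideal.span (Set.range (PerfPoly.X p B (n := n))))

theorem exists_acrisHullToPDComplete :
    ∃ G : AcrisHull p C →+* PDComplete p n B,
      (∀ r, G (PDHull.of _ _ r) = wittToPDComplete hπ hker r) ∧
      ∀ m x, (m.factorial : PDComplete p n B) * G (PDHull.dp _ _ m x) =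
        wittToPDComplete hπ hker x ^ m :=
  PDHull.exists_lift _ (PDComplete.eq_zero_of_p_mul p n B)
    fun _ hr => wittToPDComplete_mem_factorialIdeal hπ hker hr

variable {G : AcrisHull p C →+* PDComplete p n B}
  (hG : ∀ r, G (PDHull.of _ _ r) = wittToPDComplete hπ hker r)
  (hG' : ∀ m x, (m.factorial : PDComplete p n B) * G (PDHull.dp _ _ m x) =
    wittToPDComplete hπ hker x ^ m)

include hG' in
theorem exists_map_dp_kerX (i : Fin n) (m : ℕ) : ∃ e : pdPoly p n B,
    (m.factorial : pdPoly p n B) * e =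
      PDPoly.monomial p n B (.ofAdd (m • Pi.single i (PExp.one p))) ∧
    G (PDHull.dp _ _ m (AcrisHull.kerX hker i)) = PDComplete.ofPoly p n B e := by
  obtain ⟨e, he⟩ := PDComplete.exists_factorial_mul (B := B) i m
  refine ⟨e, by rw [he, ofAdd_nsmul, map_pow], ?_⟩
  refine natCast_mul_cancel ((wittToPDComplete hπ hker).comp (zpToWitt p _))
    (PDComplete.eq_zero_of_p_mul p n B) (Nat.factorial_ne_zero m) ?_
  rw [hG', ← map_natCast (PDComplete.ofPoly p n B), ← map_mul, he, map_pow]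
  congr 1
  exact wittToPDComplete_teichmuller_single hπ hker _

include hG hG' in
-- The spanning element indexed by `α` corresponds modulo `p` to `b x^α / ⌊α⌋!`, whose only possibly
-- nonzero residue is `b`, at `α`.
theorem exists_dividedMonomials_single (α : Fin n → PExp p) (b : B) :
    ∃ (d : AcrisHull p C) (m : pdPoly p n B),
      AcrisHull.red p C d = AcrisHull.dividedMonomials hker (AddMonoidAlgebra.single α b) ∧
      (p : PDComplete p n B) ∣ G d - PDComplete.ofPoly p n B m ∧
      ∀ β, PDPoly.residue p n B β m = (AddMonoidAlgebra.single α b : PerfPoly p B n).coeff β := by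
  obtain ⟨w, rfl⟩ := constantCoeff_surjective p b
  choose e he he' using fun i => exists_map_dp_kerX hπ hker hG' i (PExp.floor (α i))
  let q : PerfPoly p B n := AddMonoidAlgebra.single (fun i => PExp.frac (α i)) (constantCoeff w)
  let μ : pdPoly p n B := PDPoly.monomial p n B (.ofAdd fun i => PExp.frac (α i))
  refine ⟨PDHull.of _ _ (teichmuller p (toTiltOfPerfPoly π q)) *
      ∏ i, PDHull.dp _ _ (PExp.floor (α i)) (AcrisHull.kerX hker i),
    PDPoly.const p n B w * (μ * ∏ i, e i), ?_, ?_, fun β => ?_⟩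
  · rw [AcrisHull.dividedMonomials_single, map_mul, map_prod, ← AcrisHull.ofTilt_eq]
    rfl
  · have h1 : (p : PDComplete p n B) ∣
        wittToPDComplete hπ hker (teichmuller p (toTiltOfPerfPoly π q)) -
          PDComplete.ofPoly p n B (PDPoly.const p n B w * μ) := by
      rw [← PDComplete.mod_eq_zero_iff, map_sub, mod_wittToPDComplete_teichmuller,
        PDComplete.ofPerfPoly_single, sub_self]
    rw [map_mul, map_prod, hG, ← mul_assoc, map_mul, map_prod, prod_congr rfl fun i _ => he' i,
      ← sub_mul]
    exact Dvd.dvd.mul_right h1 _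
  · refine PDPoly.residue_const_mul w α β _ ?_
    rw [factFloor, Nat.cast_prod, mul_left_comm, ← prod_mul_distrib,
      prod_congr rfl fun i _ => he i, ← map_prod, ← ofAdd_sum, ← map_mul, ← ofAdd_add]
    congr 2
    ext1 j
    simp only [← Pi.single_smul]
    rw [Pi.add_apply, univ_sum_single]
    exact PExp.frac_add_floor (α j)

include hG hG' in
theorem exists_dividedMonomials_eq (q : PerfPoly p B n) :
    ∃ (d : AcrisHull p C) (m : pdPoly p n B),
      AcrisHull.red p C d = AcrisHull.dividedMonomials hker q ∧
      (p : PDComplete p n B) ∣ G d - PDComplete.ofPoly p n B m ∧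
      ∀ β, PDPoly.residue p n B β m = q.coeff β := by
  induction q using AddMonoidAlgebra.induction_linear with
  | zero => exact ⟨0, 0, by simp, by simp, by simp⟩
  | add f g hf hg =>
    obtain ⟨d, m, h1, h2, h3⟩ := hf
    obtain ⟨d', m', h1', h2', h3'⟩ := hg
    refine ⟨d + d', m + m', by rw [map_add, map_add, h1, h1'], ?_, fun β => ?_⟩
    · rw [map_add, map_add, add_sub_add_comm]
      exact dvd_add h2 h2'
    · rw [map_add, h3, h3', AddMonoidAlgebra.coeff_add, Finsupp.add_apply]
  | single α b => exact exists_dividedMonomials_single hπ hker hG hG' α b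

include hG hG' in
-- Modulo `p`, `d` is the divided monomial sum of some `q`, and the residues of its image recover
-- the coefficients of `q`. If the image vanishes modulo `p`, then `q = 0`.
theorem dvd_of_dvd_acrisHullToPDComplete {d : AcrisHull p C}
    (h : (p : PDComplete p n B) ∣ G d) : (p : AcrisHull p C) ∣ d := by
  obtain ⟨q, hq⟩ := AcrisHull.dividedMonomials_surjective hπ hker (AcrisHull.red p C d)
  obtain ⟨d', m, h1, h2, h3⟩ := exists_dividedMonomials_eq hπ hker hG hG' q
  rw [hq, ← sub_eq_zero, ← map_sub, AcrisHull.red_eq_zero_iff] at h1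
  have h4 : (p : PDComplete p n B) ∣ G d' := by
    have := map_dvd G h1
    rw [map_natCast, map_sub] at this
    exact (dvd_sub_left h).1 this
  have h5 := (dvd_sub_right h4).1 h2
  rw [PCompletion.dvd_algebraMap_iff] at h5
  have h6 : q = 0 := by
    ext β
    rw [← h3, PDPoly.residue_of_dvd β h5]
    rfl
  rw [← AcrisHull.red_eq_zero_iff, ← hq, h6, map_zero]

include hπ hker in
theorem ACris.eq_zero_of_p_mul_eq_zero (y : ACris p C) (h : (p : ACris p C) * y = 0) : y = 0 := by
  obtain ⟨G, hG, hG'⟩ := exists_acrisHullToPDComplete hπ hker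
  refine PCompletion.eq_zero_of_p_mul_eq_zero G (PDComplete.eq_zero_of_p_mul p n B) ?_ y h
  intro d hd
  exact dvd_of_dvd_acrisHullToPDComplete hπ hker hG hG' hd

include hπ hker in
-- Modulo `p` the image of `F r` in the divided power ring is `phi(ν_1(r_0^p)) = phi(ν_0(r_0)) =
-- phi(θ(r))`, and `phi` is injective.
theorem theta_eq_zero_of_dvd_ofWitt_frobenius (r : WittVector p (Tilt p C))
    (h : (p : ACris p C) ∣ ofWitt p C (WittVector.frobenius r)) : theta p C r = 0 := by
  obtain ⟨G, hG, -⟩ := exists_acrisHullToPDComplete hπ hker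
  rw [ofWitt_eq, PCompletion.dvd_algebraMap_iff] at h
  have h1 := map_dvd G h
  rw [map_natCast, hG, ← PDComplete.mod_eq_zero_iff, mod_wittToPDComplete,
    coeff_frobenius_charP, map_pow, nu_succ_pow] at h1
  exact eq_zero_of_phi_eq_zero hπ hker h1

end Comparison

/-! ### The zero algebra. -/

section Subsingleton

theorem exists_addEquiv_of_subsingleton (p : ℕ) [Fact p.Prime]
    (k : Type*) [Field k] [CharP k p] [PerfectRing k p]
    (N : Type*) [AddCommGroup N] [Module (WittVector p k) N] [DieudonneModule p k N]
    (C : Type*) [CommRing C] [Algebra (ZMod p) C] [Algebra k C] [Subsingleton C] :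
    ∃ e : homACris p k C N ≃+ homWitt p k C N,
      ∀ (f : homACris p k C N) (x : N), (e f).1 x = beta p C (f.1 x) := by
  have h1 : Subsingleton (WittVector p C) := ⟨fun v w => by ext i; exact Subsingleton.elim _ _⟩
  have h2 : (0 : WittVector p (Tilt p C)) = 1 := by
    ext i; exact Subsingleton.elim _ _
  have h3 : Subsingleton (ACris p C) := subsingleton_of_zero_eq_one (by
    rw [← map_zero (ofWitt p C), h2, map_one])
  obtain ⟨e, -⟩ := exists_addEquiv_of_bijective (0 : homACris p k C N →+ homWitt p k C N)
    ⟨fun f g _ => Subtype.ext (LinearMap.ext fun x => Subsingleton.elim _ _),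
      fun g => ⟨0, Subtype.ext (LinearMap.ext fun x => Subsingleton.elim _ _)⟩⟩
  exact ⟨e, fun f x => Subsingleton.elim _ _⟩

end Subsingleton

end Acris

end

theorem mainTheorem2 (p : ℕ) [Fact p.Prime]
    (k : Type*) [Field k] [CharP k p] [PerfectRing k p]
    (N : Type*) [AddCommGroup N] [Module (WittVector p k) N] [Acris.DieudonneModule p k N]
    [Module.Free (WittVector p k) N] [Module.Finite (WittVector p k) N]
    (hV : Acris.VTopNilpotent p k N)
    (C : Type*) [CommRing C] [Algebra (ZMod p) C] [Algebra k C]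
    (hC : Acris.IsGood p k C) :
    ∃ e : Acris.homACris p k C N ≃+ Acris.homWitt p k C N,
      ∀ (f : Acris.homACris p k C N) (x : N), (e f).1 x = Acris.beta p C (f.1 x) := by
  -- The zero ring is good but does not satisfy `CharP C p`, so it is set apart; both groups are
  -- then trivial.
  rcases subsingleton_or_nontrivial C with _ | _
  · exact Acris.exists_addEquiv_of_subsingleton p k N C
  obtain ⟨B, _, _, _, n, ⟨i⟩⟩ := hC
  have : CharP C p := charP_of_injective_algebraMap (algebraMap (ZMod p) C).injective p
  obtain ⟨π, hπ, hker⟩ : ∃ π : Acris.PerfPoly p B n →+* C, Function.Surjective π ∧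
      RingHom.ker π = Ideal.span (Set.range (Acris.PerfPoly.X p B (n := n))) := by
    refine ⟨i.symm.toRingEquiv.toRingHom.comp (Ideal.Quotient.mk _),
      i.symm.surjective.comp Ideal.Quotient.mk_surjective, ?_⟩
    ext q
    rw [RingHom.mem_ker, RingHom.comp_apply]
    exact (map_eq_zero_iff i.symm i.symm.injective).trans Ideal.Quotient.eq_zero_iff_mem
  -- `B` must be nonzero to have characteristic `p`; otherwise the polynomial ring, and with it `C`,
  -- would be zero.
  have : Nontrivial B := by
    by_contra h
    rw [not_nontrivial_iff_subsingleton] at h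
    have h1 : (0 : Acris.PerfPoly p B n) = 1 := by
      ext α; exact Subsingleton.elim _ _
    have h2 := congrArg π h1
    rw [map_zero, map_one] at h2
    exact zero_ne_one h2
  have : CharP B p := charP_of_injective_algebraMap (algebraMap k B).injective p
  exact Acris.exists_addEquiv p k N C hV (Acris.ACris.eq_zero_of_p_mul_eq_zero hπ hker)
    (Acris.theta_eq_zero_of_dvd_ofWitt_frobenius hπ hker) (Acris.nu_surjective hπ 0)
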